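/- **Setting.** Let $G$ be a smooth Lie group (modelled on a real Banach space) with Lie algebra $\mathfrak g=T_1G$, let $G$ act smoothly, linearly and on the right on a normed space $V$, hence on the right on $V^*$ by $\langle ah,v\rangle=\langle a,vh^{-1}\rangle$, and let $a\eta$ ($a\in V^*$, $\eta\in\mathfrak g$) be the infinitesimal action. Let $L:TG\times V^*\to\mathbb R$ be smooth and right $G$-invariant, $L(v_gh,ah)=L(v_g,a)$, and put $\ell(v_gg^{-1},ag^{-1})=L(v_g,a)$, a function on $\mathfrak g\times V^*$. Fix $a_0\in V^*$, $L_{a_0}=L(\cdot,a_0)$ and $t_1<t_2$. For $u,\eta\in\mathfrak g$ put $\mathrm{ad}_u\eta=\eta u-u\eta=-[u,\eta]$, $-\langle\mathrm{ad}^*_um,\eta\rangle=\langle m,\mathrm{ad}_u\eta\rangle$ and $-\langle b\diamond a,\eta\rangle=\langle b,a\eta\rangle$. Let the overline denote the mean over a probability space. Let $g(t)=\Xi(t)\,\tilde g(t)$, where $\tilde g$ is a smooth nonrandom curve in $G$ and $\Xi$ is a random smooth curve in $G$, and suppose $\overline{g(t)}=\tilde g(t)$ for $t\in[t_1,t_2]$;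 here $G$ acts on a set of labels, every label has a position in a Banach space, and means are taken of positions $g(t)\cdot x_0$ at fixed label $x_0$. Put $\tilde u=\dot{\tilde g}\tilde g^{-1}\in\mathfrak g$, $\tilde a=a_0\tilde g^{-1}$, $u^\xi=\dot g\,\tilde g^{-1}=\dot\Xi+T\Xi\cdot\tilde u\in T_\Xi G$, where $T\Xi$ is the tangent map of left translation by $\Xi$, and $a^\xi=\mathcal F^{-1}\tilde a$, where $\mathcal F^{-1}b=b\,\Xi^{-1}$ (so $a^\xi$ is $a=a_0g^{-1}$). By $\ell(u^\xi,a^\xi)$ we mean $\ell$ evaluated at the velocity $u=u^\xi\Xi^{-1}=\dot gg^{-1}$ and at $a$. Assume that, as a random function of $(t,\tilde u,\tilde a)\in\mathbb R\times\mathfrak g\times V^*$, the function $\ell(\dot\Xi+T\Xi\cdot\tilde u,\ \mathcal F^{-1}\tilde a)$ is measurable and has its derivatives of order at most $2$ bounded on each compact set by an integrable random variable (so that the mean commutes with derivatives). **Theorem (Lagrangian Averaged Euler–Poincaré).** The following are equivalent. (i) The averaged Hamilton principle $\delta\int_{t_1}^{t_2}\overline{L_{a_0}(g,\dot g)}\,dt=0$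 holds for all smooth variations of $g=\Xi\tilde g$ with $\Xi$ fixed (i.e. $\delta g=T\Xi\cdot\delta\tilde g$) and with fixed endpoints. (ii) The mean Euler–Lagrange equations hold on $[t_1,t_2]$: $$\overline{\Big(\frac{\delta L_{a_0}}{\delta g}-\frac{d}{dt}\frac{\delta L_{a_0}}{\delta\dot g}\Big)\cdot T\Xi}=0\quad\text{in }T^*_{\tilde g(t)}G .$$ (iii) The averaged constrained principle $\delta\int_{t_1}^{t_2}\overline{\ell(u^\xi,a^\xi)}\,dt=0$ holds for the variations $$\delta u^\xi=T\Xi\cdot(\partial_t\tilde\eta+\mathrm{ad}_{\tilde u}\tilde\eta),\qquad \delta a^\xi=\mathcal F^{-1}\delta\tilde a,\qquad \delta\tilde a=-\tilde a\,\tilde\eta,$$ for all smooth $\tilde\eta:\mathbb R\to\mathfrak g$ with $\tilde\eta(t_1)=\tilde\eta(t_2)=0$. (iv) The Lagrangian-averaged Euler–Poincaré equations hold on $[t_1,t_2]$ in $\mathfrak g^*$ (tested against each fixed $\eta\in\mathfrak g$): $$\frac{\partial\bar m}{\partial t}=-\mathrm{ad}^*_{\tilde u}\bar m+\overline{\Big(\frac{\delta\ell}{\delta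 a^\xi}\cdot\mathcal F^{-1}\Big)}\diamond\tilde a,\qquad \bar m=\overline{\frac{\delta\ell}{\delta u^\xi}\cdot T\Xi}.$$ -/

import Mathlib

open MeasureTheory
open scoped Manifold ContDiff

namespace LAEP

noncomputable section

variable {E : Type*} [NormedAddCommGroup E] [NormedSpace ℝ E]
  {G : Type*} [TopologicalSpace G] [ChartedSpace E G] [Group G]
  {V : Type*} [NormedAddCommGroup V] [NormedSpace ℝ V]

/-! ### Translations, velocities, the reduced phase space

`G` is a Lie group modelled on the Banach space `E`, `GroupLieAlgebra 𝓘(ℝ, E) G` is its Lie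
algebra `𝔤 = T_1 G`. Mathlib's tangent spaces are copies of the model space `E`; this is used to
regard `T_{k * 1} G`, `T_{k * k⁻¹} G`, ... as `T_k G`, `T_1 G`, ... -/

/-- The tangent lift of left translation, `v ↦ k v : T_h G → T_{k h} G`. For a fluctuation map
`k = Ξ` this is `v ↦ TΞ · v`. -/
def leftTranslate (k : G) {h : G} (v : TangentSpace 𝓘(ℝ, E) h) : TangentSpace 𝓘(ℝ, E) (k * h) :=
  mfderiv 𝓘(ℝ, E) 𝓘(ℝ, E) (fun x : G => k * x) h v

/-- The operator `TΞ : 𝔤 → T_Ξ G`, the tangent lift of left translation by `Ξ = k` at the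
identity. -/
def tangentFactor (k : G) (u : GroupLieAlgebra 𝓘(ℝ, E) G) : TangentSpace 𝓘(ℝ, E) k :=
  mfderiv 𝓘(ℝ, E) 𝓘(ℝ, E) (fun x : G => k * x) (1 : G) u

/-- The tangent lift of right translation, `v ↦ v h : T_g G → T_{g h} G`. -/
def rightTranslate (h : G) {g : G} (v : TangentSpace 𝓘(ℝ, E) g) : TangentSpace 𝓘(ℝ, E) (g * h) :=
  mfderiv 𝓘(ℝ, E) 𝓘(ℝ, E) (fun x : G => x * h) g v

/-- Right translation to the identity, `w ↦ w k⁻¹ : T_k G → 𝔤`. -/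
def toLieAlgebra {k : G} (w : TangentSpace 𝓘(ℝ, E) k) : GroupLieAlgebra 𝓘(ℝ, E) G :=
  mfderiv 𝓘(ℝ, E) 𝓘(ℝ, E) (fun x : G => x * k⁻¹) k w

variable (E) in
/-- The velocity `ċ(t) ∈ T_{c(t)} G` of a curve in `G`. -/
def velocity (c : ℝ → G) (t : ℝ) : TangentSpace 𝓘(ℝ, E) (c t) :=
  mfderiv 𝓘(ℝ, ℝ) 𝓘(ℝ, E) c t (1 : ℝ)

variable (E) in
/-- The tangent lift `(c(t), ċ(t)) ∈ TG` of a curve in `G`. -/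
def lift (c : ℝ → G) (t : ℝ) : TangentBundle 𝓘(ℝ, E) G :=
  ⟨c t, velocity E c t⟩

variable (E) in
/-- The Eulerian velocity `u(t) = ċ(t) c(t)⁻¹ ∈ 𝔤` of a curve in `G`. -/
def eulerVelocity (c : ℝ → G) (t : ℝ) : GroupLieAlgebra 𝓘(ℝ, E) G :=
  toLieAlgebra (velocity E c t)

/-- `ad_u η = η u - u η = -[u, η]`, where `[u, η]` is the bracket of the Lie algebra of `G`
(the commutator `u η - η u` for a matrix group). -/
def ad (u η : GroupLieAlgebra 𝓘(ℝ, E) G) : GroupLieAlgebra 𝓘(ℝ, E) G :=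
  -⁅u, η⁆

/-- The covector `ad*_u m`, given by `-⟨ad*_u m, η⟩ = ⟨m, ad_u η⟩`. Covectors are represented by
their pairings with the elements of `𝔤`. -/
def coad (u : GroupLieAlgebra 𝓘(ℝ, E) G) (m : GroupLieAlgebra 𝓘(ℝ, E) G → ℝ)
    (η : GroupLieAlgebra 𝓘(ℝ, E) G) : ℝ :=
  -m (ad u η)

/-! ### Advected quantities -/

variable (E G V) in
/-- A smooth right representation of the Lie group `G` on the vector space `V`;
`act h v` is `v h`. -/
structure RightRep where
  act : G → V →L[ℝ] V
  act_one : ∀ v, act 1 v = v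
  act_mul : ∀ g h v, act (g * h) v = act h (act g v)
  smooth : ContMDiff 𝓘(ℝ, E) 𝓘(ℝ, V →L[ℝ] V) ∞ act

/-- The induced right action `(a, h) ↦ a h` of `G` on `V*`, `⟨a h, v⟩ = ⟨a, v h⁻¹⟩`. -/
def RightRep.coact (ρ : RightRep E G V) (a : StrongDual ℝ V) (h : G) : StrongDual ℝ V :=
  a.comp (ρ.act h⁻¹)

/-- The infinitesimal action `a η` of `η ∈ 𝔤` on `a ∈ V*` (the Lie derivative `£_η a`), i.e. the
derivative of `h ↦ a h` at `h = 1` in the direction `η`. -/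
def RightRep.infAct (ρ : RightRep E G V) (a : StrongDual ℝ V)
    (η : GroupLieAlgebra 𝓘(ℝ, E) G) : StrongDual ℝ V :=
  mfderiv 𝓘(ℝ, E) 𝓘(ℝ, StrongDual ℝ V) (fun h : G => ρ.coact a h) (1 : G) η

/-- The covector `b ◇ a ∈ 𝔤*`, given by `-⟨b ◇ a, η⟩ = ⟨b, a η⟩`, for `b` dual to `V*`. -/
def RightRep.diamond (ρ : RightRep E G V) (b : StrongDual ℝ V → ℝ) (a : StrongDual ℝ V)
    (η : GroupLieAlgebra 𝓘(ℝ, E) G) : ℝ :=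
  -b (ρ.infAct a η)

/-- Advective transport `a(t) = a₀ c(t)⁻¹` along the curve `c`. -/
def RightRep.advected (ρ : RightRep E G V) (a₀ : StrongDual ℝ V) (c : ℝ → G) (t : ℝ) :
    StrongDual ℝ V :=
  ρ.coact a₀ (c t)⁻¹

/-- The inverse `𝓕⁻¹ = 𝓕(Ξ)⁻¹` of the transformation factor of advected quantities under the
change of variables `Ξ`. Since `ã = a Ξ = 𝓕 · a^ξ`, one has `𝓕⁻¹ · ã = ã Ξ⁻¹`: like the
argument `u = u^ξ Ξ⁻¹` of the reduced Lagrangian, the quantity `a^ξ` (that is, `a` at the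
displaced position) is recorded by the element `a` of `V*`. -/
def RightRep.factorInv (ρ : RightRep E G V) (Ξ : G) (b : StrongDual ℝ V) : StrongDual ℝ V :=
  ρ.coact b Ξ⁻¹

/-! ### Lagrangians -/

variable [LieGroup 𝓘(ℝ, E) ∞ G]

/-- Right `G`-invariance of `L : TG × V* → ℝ`, i.e. `L(v_g h, a h) = L(v_g, a)`. -/
def RightInvariant (ρ : RightRep E G V)
    (L : TangentBundle 𝓘(ℝ, E) G → StrongDual ℝ V → ℝ) : Prop :=
  ∀ (g h : G) (v : TangentSpace 𝓘(ℝ, E) g) (a : StrongDual ℝ V),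
    L ⟨g * h, rightTranslate h v⟩ (ρ.coact a h) = L ⟨g, v⟩ a

/-- Smoothness of `L` on `TG × V*`. -/
def SmoothLagrangian (L : TangentBundle 𝓘(ℝ, E) G → StrongDual ℝ V → ℝ) : Prop :=
  ContMDiff ((𝓘(ℝ, E).tangent).prod 𝓘(ℝ, StrongDual ℝ V)) 𝓘(ℝ, ℝ) ∞
    (fun p : TangentBundle 𝓘(ℝ, E) G × StrongDual ℝ V => L p.1 p.2)

/-- The reduced Lagrangian `ℓ : 𝔤 × V* → ℝ`; by right invariance of `L` it satisfies
`ℓ(v_g g⁻¹, a g⁻¹) = L(v_g, a)`. -/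
def reduced (L : TangentBundle 𝓘(ℝ, E) G → StrongDual ℝ V → ℝ)
    (u : GroupLieAlgebra 𝓘(ℝ, E) G) (a : StrongDual ℝ V) : ℝ :=
  L ⟨1, u⟩ a

/-- `ℓ(u^ξ, a^ξ)`, the reduced Lagrangian as a function of `u^ξ ∈ T_Ξ G`: the Eulerian velocity
with the values `u^ξ = u ∘ Ξ` is `u = u^ξ Ξ⁻¹`. -/
def reducedAt (L : TangentBundle 𝓘(ℝ, E) G → StrongDual ℝ V → ℝ) {Ξ : G}
    (w : TangentSpace 𝓘(ℝ, E) Ξ) (b : StrongDual ℝ V) : ℝ :=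
  reduced L (toLieAlgebra w) b

/-- `δℓ/δu^ξ` at `(u^ξ, a^ξ) = (w, b)`, a linear functional on `T_Ξ G`. -/
def derivVelocity (L : TangentBundle 𝓘(ℝ, E) G → StrongDual ℝ V → ℝ) {Ξ : G}
    (w : TangentSpace 𝓘(ℝ, E) Ξ) (b : StrongDual ℝ V) : TangentSpace 𝓘(ℝ, E) Ξ →L[ℝ] ℝ :=
  fderiv ℝ (fun w' : TangentSpace 𝓘(ℝ, E) Ξ => reducedAt L w' b) w

/-- `δℓ/δa^ξ` at `(u^ξ, a^ξ) = (w, b)`, a linear functional on `V*`. -/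
def derivAdvected (L : TangentBundle 𝓘(ℝ, E) G → StrongDual ℝ V → ℝ) {Ξ : G}
    (w : TangentSpace 𝓘(ℝ, E) Ξ) (b : StrongDual ℝ V) : StrongDual ℝ V →L[ℝ] ℝ :=
  fderiv ℝ (fun b' : StrongDual ℝ V => reducedAt L w b') b

/-- The Euler-Lagrange covector `δL/δg - (d/dt) δL/δġ ∈ T*_{c(t)} G` of a Lagrangian
`L : TG → ℝ` along the curve `c` at time `t`, paired with `w ∈ T_{c(t)} G`; it is computed in the
coordinates `(x, v)` on `TG` given by the chart at `c(t)`, in which `w` has the components `w`. -/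
def eulerLagrange (L : TangentBundle 𝓘(ℝ, E) G → ℝ) (c : ℝ → G) (t : ℝ)
    (w : TangentSpace 𝓘(ℝ, E) (c t)) : ℝ :=
  let φ := extChartAt 𝓘(ℝ, E).tangent (lift E c t)
  let Lloc : E × E → ℝ := fun q => L (φ.symm q)
  fderiv ℝ Lloc (φ (lift E c t)) ((w : E), (0 : E))
    - deriv (fun τ : ℝ => fderiv ℝ Lloc (φ (lift E c τ)) ((0 : E), (w : E))) t

/-! ### The averaged theory

`Ω` with the probability measure `μ` is the ensemble over which means are taken, and
`g(t) = Ξ(t) g̃(t)` with a random `Ξ` and a nonrandom `g̃`. -/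

variable {Ω : Type*}

/-- The curve `g(t) = Ξ(t) g̃(t)`. -/
def glm (Ξ : ℝ → G) (g : ℝ → G) : ℝ → G := fun t => Ξ t * g t

variable (E) in
/-- `u^ξ(t) = ġ(t) g̃(t)⁻¹ ∈ T_{Ξ(t)} G`, where `g = Ξ g̃`. -/
def uXi (Ξ g : ℝ → G) (t : ℝ) : TangentSpace 𝓘(ℝ, E) (Ξ t) :=
  mfderiv 𝓘(ℝ, E) 𝓘(ℝ, E) (fun x : G => x * (g t)⁻¹) (Ξ t * g t) (velocity E (glm Ξ g) t)

/-- `a^ξ(t) = 𝓕⁻¹ ã(t)`, with `ã(t) = a₀ g̃(t)⁻¹`. -/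
def RightRep.aXi (ρ : RightRep E G V) (a₀ : StrongDual ℝ V) (Ξ g : ℝ → G) (t : ℝ) :
    StrongDual ℝ V :=
  ρ.factorInv (Ξ t) (ρ.advected a₀ g t)

/-- The fluctuating Lagrangian in the mean variables: the value of `ℓ(u^ξ, a^ξ)` at
`u^ξ = ∂Ξ/∂t + TΞ · ũ` and `a^ξ = 𝓕⁻¹ ã`, as a function of `(t, ũ, ã) ∈ ℝ × 𝔤 × V*`. -/
def fluctuatingLagrangian (ρ : RightRep E G V)
    (L : TangentBundle 𝓘(ℝ, E) G → StrongDual ℝ V → ℝ) (Ξ : ℝ → G)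
    (p : ℝ × E × StrongDual ℝ V) : ℝ :=
  reducedAt L (velocity E Ξ p.1 + tangentFactor (Ξ p.1) p.2.1) (ρ.factorInv (Ξ p.1) p.2.2)

/-- The mean may be differentiated twice under the integral sign: the random function `f` is
measurable, and its derivatives up to order two are dominated, on every compact set, by an
integrable random variable. -/
def DominatedC2 [MeasurableSpace Ω] (μ : Measure Ω) {F : Type*} [NormedAddCommGroup F]
    [NormedSpace ℝ F] (f : Ω → F → ℝ) : Prop :=
  (∀ p, AEStronglyMeasurable (fun σ => f σ p) μ) ∧
  ∀ C : Set F, IsCompact C → ∃ B : Ω → ℝ, Integrable B μ ∧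
    ∀ᵐ σ ∂μ, ∀ p ∈ C, ∀ k : ℕ, k ≤ 2 → ‖iteratedFDeriv ℝ k (f σ) p‖ ≤ B σ

/-- The mean of `g = Ξ g̃` is `g̃` at time `t`: averaging is done at fixed labels `x₀ ∈ M`, on
which `G` acts, by averaging the current positions `g(t) · x₀` in the linear space `X`. -/
def MeanIs [MeasurableSpace Ω] (μ : Measure Ω) {M X : Type*} [MulAction G M]
    [NormedAddCommGroup X] [NormedSpace ℝ X] (pos : M → X) (g : Ω → G) (gbar : G) : Prop :=
  ∀ x₀ : M, Integrable (fun σ => pos (g σ • x₀)) μ ∧ ∫ σ, pos (g σ • x₀) ∂μ = pos (gbar • x₀)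

variable (E) in
/-- Smooth variations `γ s` of the curve `g = γ 0` with fixed values at `t₁` and `t₂`. -/
def IsVariation (t₁ t₂ : ℝ) (g : ℝ → G) (γ : ℝ → ℝ → G) : Prop :=
  ContMDiff 𝓘(ℝ, ℝ × ℝ) 𝓘(ℝ, E) ∞ (fun p : ℝ × ℝ => γ p.1 p.2) ∧
  γ 0 = g ∧ (∀ s, γ s t₁ = g t₁) ∧ ∀ s, γ s t₂ = g t₂

variable [MeasurableSpace Ω]

/-- The averaged Hamilton principle `δ ∫ mean(L_{a₀}(g, ġ)) dt = 0`, for the variations of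
`g = Ξ g̃` that vanish at the endpoints and leave `Ξ` fixed, i.e. `δg = TΞ · δg̃`. -/
def AveragedHamilton (μ : Measure Ω) (t₁ t₂ : ℝ)
    (L : TangentBundle 𝓘(ℝ, E) G → StrongDual ℝ V → ℝ) (a₀ : StrongDual ℝ V)
    (Ξ : Ω → ℝ → G) (g : ℝ → G) : Prop :=
  ∀ γ : ℝ → ℝ → G, IsVariation E t₁ t₂ g γ →
    HasDerivAt (fun s : ℝ => ∫ t in t₁..t₂, ∫ σ, L (lift E (glm (Ξ σ) (γ s)) t) a₀ ∂μ) 0 0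

/-- The mean Euler-Lagrange equations
`mean((δL_{a₀}/δg) · TΞ - (d/dt δL_{a₀}/δġ) · TΞ) = 0` in `T*_{g̃(t)} G`. -/
def MeanEulerLagrange (μ : Measure Ω) (t₁ t₂ : ℝ)
    (L : TangentBundle 𝓘(ℝ, E) G → StrongDual ℝ V → ℝ) (a₀ : StrongDual ℝ V)
    (Ξ : Ω → ℝ → G) (g : ℝ → G) : Prop :=
  ∀ t ∈ Set.Icc t₁ t₂, ∀ w : TangentSpace 𝓘(ℝ, E) (g t),
    Integrable (fun σ => eulerLagrange (fun q => L q a₀) (glm (Ξ σ) g) t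
      (leftTranslate (Ξ σ t) w)) μ ∧
    ∫ σ, eulerLagrange (fun q => L q a₀) (glm (Ξ σ) g) t (leftTranslate (Ξ σ t) w) ∂μ = 0

/-- The averaged constrained variational principle `δ ∫ mean(ℓ(u^ξ, a^ξ)) dt = 0`, for
`δu^ξ = TΞ · (∂η̃/∂t + ad_ũ η̃)`, `δa^ξ = 𝓕⁻¹ δã`, `δã = -ã η̃`, where `η̃` is a smooth curve in
`𝔤` that vanishes at the endpoints. -/
def AveragedReducedPrinciple (μ : Measure Ω) (t₁ t₂ : ℝ) (ρ : RightRep E G V)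
    (L : TangentBundle 𝓘(ℝ, E) G → StrongDual ℝ V → ℝ) (a₀ : StrongDual ℝ V)
    (Ξ : Ω → ℝ → G) (g : ℝ → G) : Prop :=
  ∀ η : ℝ → GroupLieAlgebra 𝓘(ℝ, E) G, ContDiff (F := E) ℝ ∞ η → η t₁ = 0 → η t₂ = 0 →
    HasDerivAt (fun ε : ℝ => ∫ t in t₁..t₂, ∫ σ,
      reducedAt L
        (uXi E (Ξ σ) g t + ε • tangentFactor (Ξ σ t) (deriv η t + ad (eulerVelocity E g t) (η t)))
        (ρ.aXi a₀ (Ξ σ) g t + ε • ρ.factorInv (Ξ σ t) (-ρ.infAct (ρ.advected a₀ g t) (η t)))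
      ∂μ) 0 0

/-- `m̄(t) = mean((δℓ/δu^ξ) · TΞ) ∈ 𝔤*`. -/
def meanMomentum (μ : Measure Ω) (ρ : RightRep E G V)
    (L : TangentBundle 𝓘(ℝ, E) G → StrongDual ℝ V → ℝ) (a₀ : StrongDual ℝ V)
    (Ξ : Ω → ℝ → G) (g : ℝ → G) (t : ℝ) (η : GroupLieAlgebra 𝓘(ℝ, E) G) : ℝ :=
  ∫ σ, derivVelocity L (uXi E (Ξ σ) g t) (ρ.aXi a₀ (Ξ σ) g t) (tangentFactor (Ξ σ t) η) ∂μ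

/-- `mean((δℓ/δa^ξ) · 𝓕⁻¹)`, a linear functional on `V*`. -/
def meanForce (μ : Measure Ω) (ρ : RightRep E G V)
    (L : TangentBundle 𝓘(ℝ, E) G → StrongDual ℝ V → ℝ) (a₀ : StrongDual ℝ V)
    (Ξ : Ω → ℝ → G) (g : ℝ → G) (t : ℝ) (α : StrongDual ℝ V) : ℝ :=
  ∫ σ, derivAdvected L (uXi E (Ξ σ) g t) (ρ.aXi a₀ (Ξ σ) g t) (ρ.factorInv (Ξ σ t) α) ∂μ

/-- The Lagrangian-averaged Euler-Poincaré equations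
`∂m̄/∂t = -ad*_ũ m̄ + mean((δℓ/δa^ξ) · 𝓕⁻¹) ◇ ã` in `𝔤*`, paired with the elements of `𝔤`. -/
def LAEPEquations (μ : Measure Ω) (t₁ t₂ : ℝ) (ρ : RightRep E G V)
    (L : TangentBundle 𝓘(ℝ, E) G → StrongDual ℝ V → ℝ) (a₀ : StrongDual ℝ V)
    (Ξ : Ω → ℝ → G) (g : ℝ → G) : Prop :=
  ∀ t ∈ Set.Icc t₁ t₂, ∀ η : GroupLieAlgebra 𝓘(ℝ, E) G,
    HasDerivAt (fun τ : ℝ => meanMomentum μ ρ L a₀ Ξ g τ η)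
      (-coad (eulerVelocity E g t) (meanMomentum μ ρ L a₀ Ξ g t) η
        + ρ.diamond (meanForce μ ρ L a₀ Ξ g t) (ρ.advected a₀ g t) η) t

end

end LAEP

set_option linter.unusedSectionVars false

namespace LAEP

/-! ### Manifold derivatives read in charts. -/

section Charts

variable {E : Type*} [NormedAddCommGroup E] [NormedSpace ℝ E]
  {G : Type*} [TopologicalSpace G] [ChartedSpace E G]
  {F : Type*} [NormedAddCommGroup F] [NormedSpace ℝ F]

/-! By right invariance and the product rule for `ċ c⁻¹`, the Lagrangian along a curve `Ξ c` sees
`c` only through the point `(t, ċ c⁻¹, a₀ c⁻¹)` of the fixed normed space `ℝ × 𝔤 × V*`: it equals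
`f_σ` at that point, where `f_σ = fluctuatingLagrangian ρ L (Ξ σ)` is smooth
(`lagrangian_lift_glm`). All randomness sits in `f_σ`, and a variation moves only the nonrandom
point. The domination hypothesis lets the mean commute with the derivatives of `f_σ`.

If `c` varies with `η = δc c⁻¹`, the point varies by `(0, ∂_t η + ad_u η, -ã η)`. The middle entry
is the structure equation `maurer_cartan`, which comes from equality of mixed partial derivatives in
the chart at the identity. Integrating the term in `∂_t η` by parts (`integral_residual`) turns the
first variation into `∫ mean(R_σ(t, η(t))) dt`, where `R_σ` (`residual`) is homogeneous in `η(t)`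
and free of `∂_t η`.

Each of the four conditions is equivalent to `mean(R_σ(t, η)) = 0` for all `t ∈ [t₁, t₂]` and `η ∈
𝔤`. For the two variational principles this is the fundamental lemma of the calculus of variations
(`mean_residual_eq_zero`). For the averaged Euler–Poincaré equations, `mean(R_σ)` is the right side
minus the derivative of the mean momentum. For the mean Euler–Lagrange equations, the covector
paired with `TΞ · w` is already `R_σ(t, η)` for each `σ`, with a nonrandom `η = w g̃⁻¹`
(`eulerLagrange_glm`). -/

theorem mfderiv_eq_fderiv_chart
    {f : F → G} {x : F} {p : G} (hf : MDifferentiableAt 𝓘(ℝ, F) 𝓘(ℝ, E) f x) (hp : f x = p) (v : F) :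
    (mfderiv 𝓘(ℝ, F) 𝓘(ℝ, E) f x v : E) = fderiv ℝ (fun y => extChartAt 𝓘(ℝ, E) p (f y)) x v := by
  subst hp
  rw [hf.mfderiv]
  simp [writtenInExtChartAt, Function.comp_def, chartAt_self_eq]
  rfl

theorem mfderiv_eq_fderiv_symm
    {f : G → F} {p : G} (hf : MDifferentiableAt 𝓘(ℝ, E) 𝓘(ℝ, F) f p) (v : E) :
    (mfderiv 𝓘(ℝ, E) 𝓘(ℝ, F) f p v : F) =
      fderiv ℝ (fun y => f ((extChartAt 𝓘(ℝ, E) p).symm y)) (extChartAt 𝓘(ℝ, E) p p) v := by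
  rw [hf.mfderiv]
  simp [writtenInExtChartAt, Function.comp_def, chartAt_self_eq]
  rfl

/-- The target chart sits at a free point `q`, because base points such as `k * k⁻¹` are only
propositionally equal to `1`. -/
theorem mfderiv_eq_fderiv_charts {G' : Type*} [TopologicalSpace G'] [ChartedSpace F G']
    {f : G → G'} {p : G} {q : G'} (hf : MDifferentiableAt 𝓘(ℝ, E) 𝓘(ℝ, F) f p) (hq : f p = q)
    (v : E) :
    (mfderiv 𝓘(ℝ, E) 𝓘(ℝ, F) f p v : F) =
      fderiv ℝ (fun y => extChartAt 𝓘(ℝ, F) q (f ((extChartAt 𝓘(ℝ, E) p).symm y)))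
        (extChartAt 𝓘(ℝ, E) p p) v := by
  subst hq
  rw [hf.mfderiv]
  simp [writtenInExtChartAt, Function.comp_def]
  rfl

theorem contMDiffAt_extChartAt_symm_self [IsManifold 𝓘(ℝ, E) ∞ G] (p : G) :
    ContMDiffAt 𝓘(ℝ, E) 𝓘(ℝ, E) ∞ (extChartAt 𝓘(ℝ, E) p).symm (extChartAt 𝓘(ℝ, E) p p) :=
  (contMDiffOn_extChartAt_symm p).contMDiffAt (extChartAt_target_mem_nhds p)

theorem contDiffAt_chart_comp [IsManifold 𝓘(ℝ, E) ∞ G] {f : F → G} {x : F} {p : G}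
    (hf : ContMDiffAt 𝓘(ℝ, F) 𝓘(ℝ, E) ∞ f x) (hp : f x = p) :
    ContDiffAt ℝ ∞ (fun y => extChartAt 𝓘(ℝ, E) p (f y)) x := by
  subst hp
  exact ((contMDiffAt_extChartAt (x := f x)).comp x hf).contDiffAt

end Charts

/-! ### The right logarithmic derivative of a curve. -/

section Group

variable {E : Type*} [NormedAddCommGroup E] [NormedSpace ℝ E]
  {G : Type*} [TopologicalSpace G] [ChartedSpace E G] [Group G]
  [LieGroup 𝓘(ℝ, E) ∞ G]
  {F : Type*} [NormedAddCommGroup F] [NormedSpace ℝ F]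

variable (E) in
theorem mdifferentiableAt_mul_right (k h : G) :
    MDifferentiableAt 𝓘(ℝ, E) 𝓘(ℝ, E) (fun x : G => x * k) h :=
  (contMDiff_mul_right (I := 𝓘(ℝ, E)) (n := ∞) (a := k)).mdifferentiable (by simp) h

variable (E) in
theorem mdifferentiableAt_mul_left (k h : G) :
    MDifferentiableAt 𝓘(ℝ, E) 𝓘(ℝ, E) (fun x : G => k * x) h :=
  (contMDiff_mul_left (I := 𝓘(ℝ, E)) (n := ∞) (a := k)).mdifferentiable (by simp) h

variable (E) in
/-- The right logarithmic derivative `ċ(t) c(t)⁻¹` of a curve, read in the chart at the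
identity. -/
noncomputable def logDeriv (c : ℝ → G) (t : ℝ) : E :=
  deriv (fun τ => extChartAt 𝓘(ℝ, E) (1 : G) (c τ * (c t)⁻¹)) t

/-- The chain rule merges the two tangent maps into the derivative of `τ ↦ c τ * (c t)⁻¹`, a curve
through `1`. From here on velocities live in the single space `E`. -/
theorem eulerVelocity_eq_logDeriv {c : ℝ → G} {t : ℝ}
    (hc : MDifferentiableAt 𝓘(ℝ, ℝ) 𝓘(ℝ, E) c t) :
    (eulerVelocity E c t : E) = logDeriv E c t := by
  have h := mdifferentiableAt_mul_right E (c t)⁻¹ (c t)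
  rw [logDeriv, ← fderiv_apply_one_eq_deriv]
  exact (mfderiv_comp_apply t h hc (1 : ℝ)).symm.trans
    (mfderiv_eq_fderiv_chart (h.comp t hc) (by simp : _ = (1 : G)) 1)

/-- The factor `k` cancels against its inverse. Hence a variation `ψ s * g τ` has the same `η` at
every time `τ`. -/
theorem logDeriv_mul_const (c : ℝ → G) (t : ℝ) (k : G) :
    logDeriv E (fun τ => c τ * k) t = logDeriv E c t := by
  simp [logDeriv, mul_assoc]

/-- Smoothness of the logarithmic derivative in parameters. -/
theorem contDiff_deriv_chart_one {f : F → ℝ → G}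
    (hf : ContMDiff 𝓘(ℝ, F × ℝ) 𝓘(ℝ, E) ∞ (fun p : F × ℝ => f p.1 p.2))
    {c : F → ℝ} (hc : ContDiff ℝ ∞ c) (h1 : ∀ x, f x (c x) = 1) :
    ContDiff ℝ ∞ (fun x => deriv (fun τ => extChartAt 𝓘(ℝ, E) (1 : G) (f x τ)) (c x)) := by
  rw [contDiff_iff_contDiffAt]
  intro x
  have hs : ∀ y, ContDiffAt ℝ ∞ (fun p : F × ℝ => extChartAt 𝓘(ℝ, E) (1 : G) (f p.1 p.2))
      (y, c y) := fun y => contDiffAt_chart_comp (hf _) (h1 y)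
  -- Writing the partial derivative as the full derivative applied to `(0, 1)` makes smoothness in
  -- the parameter a statement about `fderiv`.
  have h2 : (fun x => deriv (fun τ => extChartAt 𝓘(ℝ, E) (1 : G) (f x τ)) (c x)) =
      fun x => fderiv ℝ (fun p : F × ℝ => extChartAt 𝓘(ℝ, E) (1 : G) (f p.1 p.2))
        (x, c x) (0, 1) := by
    funext y
    have h3 := ((hs y).differentiableAt (by simp)).hasFDerivAt
    have h4 : HasDerivAt (fun τ : ℝ => (y, τ)) ((0 : F), (1 : ℝ)) (c y) :=
      (hasDerivAt_const _ _).prodMk (hasDerivAt_id _)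
    exact (h3.comp_hasDerivAt (c y) h4).deriv
  rw [h2]
  have h5 := ((hs x).fderiv_right (m := ∞) (by simp)).comp x (f := fun x => (x, c x))
    (contDiffAt_id.prodMk hc.contDiffAt)
  exact h5.clm_apply contDiffAt_const

theorem contDiff_logDeriv {c : F → ℝ → G}
    (hc : ContMDiff 𝓘(ℝ, F × ℝ) 𝓘(ℝ, E) ∞ (fun p : F × ℝ => c p.1 p.2)) {s : F → ℝ}
    (hs : ContDiff ℝ ∞ s) :
    ContDiff ℝ ∞ (fun x => logDeriv E (c x) (s x)) := by
  refine contDiff_deriv_chart_one (f := fun x τ => c x τ * (c x (s x))⁻¹) ?_ hs (by simp)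
  have h2 : ContMDiff 𝓘(ℝ, F × ℝ) 𝓘(ℝ, F × ℝ) ∞ (fun p : F × ℝ => (p.1, s p.1)) :=
    (contDiff_fst.prodMk (hs.comp contDiff_fst)).contMDiff
  exact hc.mul (hc.comp h2).inv

end Group
end LAEP

/-! ### The adjoint action and the product rule for logarithmic derivatives. -/

namespace LAEP

section Plane

variable {F : Type*} [NormedAddCommGroup F] [NormedSpace ℝ F]

theorem deriv_fst_eq_fderiv {ψ : ℝ × ℝ → F} {a b : ℝ} (h : DifferentiableAt ℝ ψ (a, b)) :
    deriv (fun x => ψ (x, b)) a = fderiv ℝ ψ (a, b) (1, 0) :=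
  (h.hasFDerivAt.comp_hasDerivAt a ((hasDerivAt_id a).prodMk (hasDerivAt_const a b))).deriv

theorem deriv_snd_eq_fderiv {ψ : ℝ × ℝ → F} {a b : ℝ} (h : DifferentiableAt ℝ ψ (a, b)) :
    deriv (fun x => ψ (a, x)) b = fderiv ℝ ψ (a, b) (0, 1) :=
  (h.hasFDerivAt.comp_hasDerivAt b ((hasDerivAt_const b a).prodMk (hasDerivAt_id b))).deriv

/-- Chain rule along a slanted line. Slope `1` is the diagonal and yields the product rule; a
general slope adds `r` times the variation field to a velocity while the base point stays put. -/
theorem deriv_comp_affine {ψ : ℝ × ℝ → F} {a b : ℝ} (h : DifferentiableAt ℝ ψ (a, b)) (r : ℝ) :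
    deriv (fun x => ψ (a + r * (x - b), x)) b =
      deriv (fun x => ψ (a, x)) b + r • deriv (fun x => ψ (x, b)) a := by
  have h1 : HasDerivAt (fun x : ℝ => (a + r * (x - b), x)) (r, 1) b := by
    refine HasDerivAt.prodMk ?_ (hasDerivAt_id b)
    simpa using (((hasDerivAt_id b).sub_const b).const_mul r).const_add a
  have h2 := (h.hasFDerivAt.comp_hasDerivAt_of_eq b h1 (by simp)).deriv
  have h3 : (fun x => ψ (a + r * (x - b), x)) = ψ ∘ fun x => (a + r * (x - b), x) := rfl
  rw [h3, h2, deriv_fst_eq_fderiv h, deriv_snd_eq_fderiv h, ← map_smul, ← map_add]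
  simp

end Plane

variable {E : Type*} [NormedAddCommGroup E] [NormedSpace ℝ E]
  {G : Type*} [TopologicalSpace G] [ChartedSpace E G] [Group G]
  [LieGroup 𝓘(ℝ, E) ∞ G]
  {F : Type*} [NormedAddCommGroup F] [NormedSpace ℝ F]

variable (E) in
/-- The adjoint action of `k` on the Lie algebra, read in the chart at the identity. -/
noncomputable def adjointOp (k : G) : E →L[ℝ] E :=
  fderiv ℝ (fun y => extChartAt 𝓘(ℝ, E) (1 : G) (k * (extChartAt 𝓘(ℝ, E) (1 : G)).symm y * k⁻¹))
    (extChartAt 𝓘(ℝ, E) (1 : G) 1)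

theorem toLieAlgebra_tangentFactor (k : G) (u : GroupLieAlgebra 𝓘(ℝ, E) G) :
    (toLieAlgebra (tangentFactor k u) : E) = adjointOp E k u := by
  have h1 := mdifferentiableAt_mul_left E k 1
  have h2 := mdifferentiableAt_mul_right E k⁻¹ k
  have h2' : MDifferentiableAt 𝓘(ℝ, E) 𝓘(ℝ, E) (fun x : G => x * k⁻¹) (k * 1) := by
    simpa using h2
  exact (mfderiv_comp_apply_of_eq (1 : G) h2 h1 (mul_one k) u).symm.trans
    (mfderiv_eq_fderiv_charts (h2'.comp (1 : G) h1) (by simp : _ = (1 : G)) u)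

theorem contMDiffAt_conj_chart {c : F → G} (hc : ContMDiff 𝓘(ℝ, F) 𝓘(ℝ, E) ∞ c) (x : F) :
    ContDiffAt ℝ ∞ (fun p : F × E => extChartAt 𝓘(ℝ, E) (1 : G)
      (c p.1 * (extChartAt 𝓘(ℝ, E) (1 : G)).symm p.2 * (c p.1)⁻¹))
      (x, extChartAt 𝓘(ℝ, E) (1 : G) 1) := by
  have h1 : ContMDiffAt 𝓘(ℝ, F × E) 𝓘(ℝ, E) ∞ (fun p : F × E => c p.1)
      (x, extChartAt 𝓘(ℝ, E) (1 : G) 1) := hc.contMDiffAt.comp _ contDiff_fst.contMDiff.contMDiffAt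
  have h2 : ContMDiffAt 𝓘(ℝ, F × E) 𝓘(ℝ, E) ∞
      (fun p : F × E => (extChartAt 𝓘(ℝ, E) (1 : G)).symm p.2)
      (x, extChartAt 𝓘(ℝ, E) (1 : G) 1) :=
    ContMDiffAt.comp (I' := 𝓘(ℝ, E)) _ (contMDiffAt_extChartAt_symm_self (1 : G))
      contDiff_snd.contMDiff.contMDiffAt
  refine contDiffAt_chart_comp ((h1.mul h2).mul h1.inv) ?_
  simp

theorem contDiff_adjointOp {c : F → G} (hc : ContMDiff 𝓘(ℝ, F) 𝓘(ℝ, E) ∞ c) :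
    ContDiff ℝ ∞ (fun x => adjointOp E (c x)) := by
  rw [contDiff_iff_contDiffAt]
  intro x
  have h := contMDiffAt_conj_chart (E := E) hc
  exact ContDiffAt.fderiv (h x) contDiffAt_const (m := ∞) (by simp)

/-- Give the two factors separate times and differentiate along the diagonal: in the first time `d
t` cancels, in the second the curve `d x * (d t)⁻¹` is conjugated by `c t`. -/
theorem logDeriv_mul {c d : ℝ → G} (hc : ContMDiff 𝓘(ℝ, ℝ) 𝓘(ℝ, E) ∞ c)
    (hd : ContMDiff 𝓘(ℝ, ℝ) 𝓘(ℝ, E) ∞ d) (t : ℝ) :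
    logDeriv E (fun τ => c τ * d τ) t =
      logDeriv E c t + adjointOp E (c t) (logDeriv E d t) := by
  let ψ : ℝ × ℝ → E := fun p => extChartAt 𝓘(ℝ, E) (1 : G) (c p.1 * d p.2 * (c t * d t)⁻¹)
  have hψ : DifferentiableAt ℝ ψ (t, t) := by
    refine (contDiffAt_chart_comp (F := ℝ × ℝ) (x := (t, t)) (p := (1 : G))
      (f := fun p : ℝ × ℝ => c p.1 * d p.2 * (c t * d t)⁻¹) ?_ (by simp)).differentiableAt (by simp)
    exact (((hc.comp contDiff_fst.contMDiff).mul (hd.comp contDiff_snd.contMDiff)).mul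
      contMDiff_const).contMDiffAt
  have h1 := deriv_comp_affine hψ 1
  have e1 : deriv (fun x => ψ (x, t)) t = logDeriv E c t := by
    simp [ψ, logDeriv, mul_assoc]
  have e2 : deriv (fun x => ψ (t, x)) t = adjointOp E (c t) (logDeriv E d t) := by
    have h3 : ContMDiffAt 𝓘(ℝ, ℝ) 𝓘(ℝ, E) ∞ (fun x : ℝ => d x * (d t)⁻¹) t :=
      (hd.mul contMDiff_const).contMDiffAt
    have h2 : HasDerivAt (fun x : ℝ => extChartAt 𝓘(ℝ, E) (1 : G) (d x * (d t)⁻¹))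
        (logDeriv E d t) t :=
      ((contDiffAt_chart_comp h3 (by simp)).differentiableAt (by simp)).hasDerivAt
    have h4 := ((contMDiffAt_conj_chart (E := E) (F := ℝ) hc t).comp
      (extChartAt 𝓘(ℝ, E) (1 : G) 1) (f := fun y => (t, y))
      (contDiffAt_const.prodMk contDiffAt_id)).differentiableAt (by simp)
    have h5 : HasFDerivAt (fun y => extChartAt 𝓘(ℝ, E) (1 : G)
        (c t * (extChartAt 𝓘(ℝ, E) (1 : G)).symm y * (c t)⁻¹)) (adjointOp E (c t))
        (extChartAt 𝓘(ℝ, E) (1 : G) (d t * (d t)⁻¹)) := by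
      rw [mul_inv_cancel]; exact h4.hasFDerivAt
    rw [← (h5.comp_hasDerivAt t h2).deriv]
    refine Filter.EventuallyEq.deriv_eq ?_
    -- Near `t` the curve `d x * (d t)⁻¹` stays in the chart domain, so passing to coordinates and
    -- back does not change it.
    have h6 := h3.continuousAt.preimage_mem_nhds
      (extChartAt_source_mem_nhds' (I := 𝓘(ℝ, E)) (x := (1 : G)) (x' := d t * (d t)⁻¹) (by simp))
    filter_upwards [h6] with x hx
    simp only [Function.comp_apply, ψ]
    rw [(extChartAt 𝓘(ℝ, E) (1 : G)).left_inv hx]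
    simp [mul_assoc]
  rw [e1, e2, one_smul, add_comm] at h1
  rw [← h1]
  simp [ψ, logDeriv]

/-- The slanted curve passes through `γ s t` at time `t` with velocity `u + r η`. This realises
fibre derivatives of a Lagrangian by actual curves in `G`. -/
theorem logDeriv_affine {γ : ℝ → ℝ → G}
    (hγ : ContMDiff 𝓘(ℝ, ℝ × ℝ) 𝓘(ℝ, E) ∞ (fun p : ℝ × ℝ => γ p.1 p.2)) (s t r : ℝ) :
    logDeriv E (fun τ => γ (s + r * (τ - t)) τ) t =
      logDeriv E (γ s) t + r • logDeriv E (fun x => γ x t) s := by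
  let ψ : ℝ × ℝ → E := fun p => extChartAt 𝓘(ℝ, E) (1 : G) (γ p.1 p.2 * (γ s t)⁻¹)
  have hψ : DifferentiableAt ℝ ψ (s, t) := by
    refine (contDiffAt_chart_comp (F := ℝ × ℝ) (x := (s, t)) (p := (1 : G))
      (f := fun p : ℝ × ℝ => γ p.1 p.2 * (γ s t)⁻¹) ?_ (by simp)).differentiableAt (by simp)
    exact (hγ.mul contMDiff_const).contMDiffAt
  have h1 := deriv_comp_affine hψ r
  simp only [ψ] at h1
  simpa [logDeriv] using h1

end LAEP

/-! ### The Lie bracket through the second derivative of the multiplication. -/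

namespace LAEP

variable {E : Type*} [NormedAddCommGroup E] [NormedSpace ℝ E]
  {G : Type*} [TopologicalSpace G] [ChartedSpace E G] [Group G]
  [LieGroup 𝓘(ℝ, E) ∞ G]

variable (E G) in
/-- The multiplication of `G` in the chart at the identity. -/
noncomputable def chartMul (p : E × E) : E :=
  extChartAt 𝓘(ℝ, E) (1 : G)
    ((extChartAt 𝓘(ℝ, E) (1 : G)).symm p.1 * (extChartAt 𝓘(ℝ, E) (1 : G)).symm p.2)

variable (E G) in
/-- The identity of `G` in the chart at the identity. -/
noncomputable def chartOne : E := extChartAt 𝓘(ℝ, E) (1 : G) 1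

variable (E G) in
theorem contDiffAt_chartMul : ContDiffAt ℝ ∞ (chartMul E G) (chartOne E G, chartOne E G) := by
  have h1 : ContMDiffAt 𝓘(ℝ, E × E) 𝓘(ℝ, E) ∞
      (fun p : E × E => (extChartAt 𝓘(ℝ, E) (1 : G)).symm p.1) (chartOne E G, chartOne E G) :=
    ContMDiffAt.comp (I' := 𝓘(ℝ, E)) _ (contMDiffAt_extChartAt_symm_self (1 : G))
      contDiff_fst.contMDiff.contMDiffAt
  have h2 : ContMDiffAt 𝓘(ℝ, E × E) 𝓘(ℝ, E) ∞
      (fun p : E × E => (extChartAt 𝓘(ℝ, E) (1 : G)).symm p.2) (chartOne E G, chartOne E G) :=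
    ContMDiffAt.comp (I' := 𝓘(ℝ, E)) _ (contMDiffAt_extChartAt_symm_self (1 : G))
      contDiff_snd.contMDiff.contMDiffAt
  exact contDiffAt_chart_comp (h1.mul h2) (by simp [chartOne])

variable (G) in
theorem eventually_mem_target : ∀ᶠ y in nhds (chartOne E G),
    y ∈ (extChartAt 𝓘(ℝ, E) (1 : G)).target := extChartAt_target_mem_nhds (1 : G)

variable (G) in
theorem fderiv_chartMul_fst (v : E) :
    fderiv ℝ (chartMul E G) (chartOne E G, chartOne E G) (v, 0) = v := by
  have h1 := ((contDiffAt_chartMul E G).differentiableAt (by simp)).hasFDerivAt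
  have h2 : HasFDerivAt (fun y : E => (y, chartOne E G)) (ContinuousLinearMap.inl ℝ E E)
      (chartOne E G) := hasFDerivAt_prodMk_left _ _
  have h3 := h1.comp (f := fun y : E => (y, chartOne E G)) (chartOne E G) h2
  have h4 : HasFDerivAt (chartMul E G ∘ fun y : E => (y, chartOne E G))
      (ContinuousLinearMap.id ℝ E) (chartOne E G) := by
    refine (hasFDerivAt_id _).congr_of_eventuallyEq ?_
    filter_upwards [eventually_mem_target G] with y hy
    have h5 : (extChartAt 𝓘(ℝ, E) (1 : G)).symm (chartOne E G) = 1 := by simp [chartOne]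
    simp only [Function.comp_apply, chartMul, h5, mul_one, id]
    exact (extChartAt 𝓘(ℝ, E) (1 : G)).right_inv hy
  have h5 := congrArg (fun T : E →L[ℝ] E => T v) (h3.unique h4)
  simpa using h5

variable (G) in
theorem fderiv_chartMul_snd (v : E) :
    fderiv ℝ (chartMul E G) (chartOne E G, chartOne E G) (0, v) = v := by
  have h1 := ((contDiffAt_chartMul E G).differentiableAt (by simp)).hasFDerivAt
  have h3 := h1.comp (f := fun y : E => (chartOne E G, y)) (chartOne E G)
    (hasFDerivAt_prodMk_right _ _)
  have h4 : HasFDerivAt (chartMul E G ∘ fun y : E => (chartOne E G, y))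
      (ContinuousLinearMap.id ℝ E) (chartOne E G) := by
    refine (hasFDerivAt_id _).congr_of_eventuallyEq ?_
    filter_upwards [eventually_mem_target G] with y hy
    have h5 : (extChartAt 𝓘(ℝ, E) (1 : G)).symm (chartOne E G) = 1 := by simp [chartOne]
    simp only [Function.comp_apply, chartMul, h5, one_mul, id]
    exact (extChartAt 𝓘(ℝ, E) (1 : G)).right_inv hy
  have h5 := congrArg (fun T : E →L[ℝ] E => T v) (h3.unique h4)
  simpa using h5

/-- The left-invariant field at `k` is the derivative at `1` of `x ↦ k * x`; in the chart this is
the partial derivative of the multiplication in its second slot. -/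
theorem mpullback_mulInvariantVectorField_eventually (v : GroupLieAlgebra 𝓘(ℝ, E) G) :
    ∀ᶠ y in nhds (chartOne E G),
      (VectorField.mpullbackWithin 𝓘(ℝ, E) 𝓘(ℝ, E) (extChartAt 𝓘(ℝ, E) (1 : G)).symm
        (mulInvariantVectorField v) (Set.range 𝓘(ℝ, E)) y : E) =
      fderiv ℝ (chartMul E G) (y, chartOne E G) ((0 : E), (v : E)) := by
  have hd : ∀ᶠ y in nhds (chartOne E G), DifferentiableAt ℝ (chartMul E G) (y, chartOne E G) := by
    have h1 : ∀ᶠ p in nhds (chartOne E G, chartOne E G), DifferentiableAt ℝ (chartMul E G) p := by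
      have := ((contDiffAt_chartMul E G).of_le (m := 1) (by simp)).eventually (by simp)
      filter_upwards [this] with p hp using hp.differentiableAt (by simp)
    have h2 : Filter.Tendsto (fun y : E => (y, chartOne E G)) (nhds (chartOne E G))
      (nhds (chartOne E G, chartOne E G)) := (Continuous.prodMk_left _).tendsto _
    exact h2.eventually h1
  filter_upwards [hd, eventually_mem_target G] with y hy hyt
  set k : G := (extChartAt 𝓘(ℝ, E) (1 : G)).symm y with hk
  have hks : k ∈ (extChartAt 𝓘(ℝ, E) (1 : G)).source :=
    (extChartAt 𝓘(ℝ, E) (1 : G)).map_target hyt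
  have hφ : MDifferentiableAt 𝓘(ℝ, E) 𝓘(ℝ, E) (extChartAt 𝓘(ℝ, E) (1 : G)) k :=
    mdifferentiableAt_extChartAt (by simpa using hks)
  have hφ' : MDifferentiableAt 𝓘(ℝ, E) 𝓘(ℝ, E) (extChartAt 𝓘(ℝ, E) (1 : G)) (k * 1) := by
    simpa using hφ
  have hm := mdifferentiableAt_mul_left E k 1
  -- The pullback along the inverse chart applies the inverse of its derivative, which is the
  -- derivative of the chart itself.
  have e1 : (mfderivWithin 𝓘(ℝ, E) 𝓘(ℝ, E) (extChartAt 𝓘(ℝ, E) (1 : G)).symm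
      (Set.range 𝓘(ℝ, E)) y).inverse =
      mfderiv 𝓘(ℝ, E) 𝓘(ℝ, E) (extChartAt 𝓘(ℝ, E) (1 : G)) k := by
    apply ContinuousLinearMap.inverse_eq
    · exact mfderivWithin_extChartAt_symm_comp_mfderiv_extChartAt hyt
    · exact mfderiv_extChartAt_comp_mfderivWithin_extChartAt_symm hyt
  have e2 : (mfderiv 𝓘(ℝ, E) 𝓘(ℝ, E) (extChartAt 𝓘(ℝ, E) (1 : G)) k
      (mfderiv 𝓘(ℝ, E) 𝓘(ℝ, E) (fun x : G => k * x) 1 v) : E) =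
      fderiv ℝ (fun z => extChartAt 𝓘(ℝ, E) (1 : G)
        (k * (extChartAt 𝓘(ℝ, E) (1 : G)).symm z)) (chartOne E G) v :=
    (mfderiv_comp_apply_of_eq (1 : G) hφ hm (mul_one k) v).symm.trans
      (mfderiv_eq_fderiv_symm (hφ'.comp (1 : G) hm) v)
  have e3 : fderiv ℝ (fun z => extChartAt 𝓘(ℝ, E) (1 : G)
        (k * (extChartAt 𝓘(ℝ, E) (1 : G)).symm z)) (chartOne E G) v =
      fderiv ℝ (chartMul E G) (y, chartOne E G) ((0 : E), (v : E)) := by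
    have h1 := hy.hasFDerivAt.comp (chartOne E G) (hasFDerivAt_prodMk_right y (chartOne E G))
    exact congrArg (fun T : E →L[ℝ] E => T v) h1.fderiv
  rw [← e3, ← e2, ← e1]
  rfl

/-- In the chart the bracket is `DU_v(U_u) - DU_u(U_v)` for left-invariant fields, and
differentiating the second-slot derivative of the multiplication in the first slot gives the mixed
second derivative. -/
theorem bracket_eq (u v : GroupLieAlgebra 𝓘(ℝ, E) G) :
    (show E from (⁅u, v⁆ : GroupLieAlgebra 𝓘(ℝ, E) G)) =
      fderiv ℝ (fderiv ℝ (chartMul E G)) (chartOne E G, chartOne E G) ((u : E), 0) ((0 : E), (v : E))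
      - fderiv ℝ (fderiv ℝ (chartMul E G)) (chartOne E G, chartOne E G) ((v : E), 0)
        ((0 : E), (u : E)) := by
  have hD : ∀ a b : E, fderiv ℝ (fun y : E => fderiv ℝ (chartMul E G) (y, chartOne E G) ((0 : E), b))
      (chartOne E G) a =
      fderiv ℝ (fderiv ℝ (chartMul E G)) (chartOne E G, chartOne E G) (a, 0) ((0 : E), b) := by
    intro a b
    have h1 := (((contDiffAt_chartMul E G).fderiv_right (m := ∞) (by simp)).differentiableAt
      (by simp)).hasFDerivAt
    have h2 := h1.comp (f := fun y : E => (y, chartOne E G)) (chartOne E G)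
      (hasFDerivAt_prodMk_left (𝕜 := ℝ) (chartOne E G) (chartOne E G))
    have h3 := (h2.clm_apply (hasFDerivAt_const ((0 : E), b) (chartOne E G))).fderiv
    have h4 := congrArg (fun T : E →L[ℝ] E => T a) h3
    simpa using h4
  have hV : ∀ b : E, fderiv ℝ (chartMul E G) (chartOne E G, chartOne E G) ((0 : E), b) = b :=
    fderiv_chartMul_snd G
  -- The manifold bracket is pulled back from the chart by the inverse of this derivative, so it has
  -- to be the identity for the formula to hold in `E` as it stands.
  have hφ : mfderiv 𝓘(ℝ, E) 𝓘(ℝ, E) (extChartAt 𝓘(ℝ, E) (1 : G)) 1 =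
      ContinuousLinearMap.id ℝ E := by
    refine ContinuousLinearMap.ext fun w => ?_
    have h1 := mfderiv_eq_fderiv_symm (mdifferentiableAt_extChartAt (I := 𝓘(ℝ, E))
      (mem_chart_source E (1 : G))) w
    refine h1.trans ?_
    have h2 : (fun y => extChartAt 𝓘(ℝ, E) (1 : G) ((extChartAt 𝓘(ℝ, E) (1 : G)).symm y))
        =ᶠ[nhds (chartOne E G)] id := by
      filter_upwards [eventually_mem_target G] with y hy
      exact (extChartAt 𝓘(ℝ, E) (1 : G)).right_inv hy
    exact congrArg (fun T : E →L[ℝ] E => T w) (h2.fderiv_eq.trans fderiv_id)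
  let U : E → E → E := fun b => VectorField.mpullbackWithin 𝓘(ℝ, E) 𝓘(ℝ, E)
    (extChartAt 𝓘(ℝ, E) (1 : G)).symm
        (mulInvariantVectorField (I := 𝓘(ℝ, E)) (G := G) b) (Set.range 𝓘(ℝ, E))
  have hU : ∀ b : E, U b =ᶠ[nhds (chartOne E G)]
      fun y => fderiv ℝ (chartMul E G) (y, chartOne E G) ((0 : E), b) :=
    fun b => mpullback_mulInvariantVectorField_eventually b
  have hL : (show E from (⁅u, v⁆ : GroupLieAlgebra 𝓘(ℝ, E) G)) =
      VectorField.lieBracket ℝ (U u) (U v) (chartOne E G) := by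
    let S : Set E := (extChartAt 𝓘(ℝ, E) (1 : G)).symm ⁻¹' Set.univ ∩ Set.range 𝓘(ℝ, E)
    let B : E := VectorField.lieBracketWithin ℝ (U u) (U v) S (chartOne E G)
    have h1 : (show E from (⁅u, v⁆ : GroupLieAlgebra 𝓘(ℝ, E) G)) =
        (mfderiv 𝓘(ℝ, E) 𝓘(ℝ, E) (extChartAt 𝓘(ℝ, E) (1 : G)) 1).inverse B := rfl
    have h2 : ∀ x : E, ((mfderiv 𝓘(ℝ, E) 𝓘(ℝ, E) (extChartAt 𝓘(ℝ, E) (1 : G)) 1).inverse x : E)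
        = x := fun x => by
      rw [hφ]
      exact congrArg (fun T : E →L[ℝ] E => T x) ContinuousLinearMap.inverse_id
    have h3 : S = Set.univ := by simp [S]
    have h4 : B = VectorField.lieBracket ℝ (U u) (U v) (chartOne E G) := by
      simp only [B, h3, VectorField.lieBracketWithin_univ]
    exact (h1.trans (h2 _)).trans h4
  have hT : ∀ a b : E, fderiv ℝ (U b) (chartOne E G) (U a (chartOne E G)) =
      fderiv ℝ (fderiv ℝ (chartMul E G)) (chartOne E G, chartOne E G) (a, 0) ((0 : E), b) := by
    intro a b
    have h1 : U a (chartOne E G) = a := (hU a).eq_of_nhds.trans (hV a)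
    rw [(hU b).fderiv_eq, h1, hD]
  exact hL.trans (congrArg₂ (· - ·) (hT u v) (hT v u))

variable (G) in
/-- The operator `(u, η) ↦ ad_u η` on the model space. -/
noncomputable def adOp (u η : E) : E :=
  show GroupLieAlgebra 𝓘(ℝ, E) G from
    ad (show GroupLieAlgebra 𝓘(ℝ, E) G from u) (show GroupLieAlgebra 𝓘(ℝ, E) G from η)

variable (G) in
theorem adOp_eq (u v : E) :
    adOp G u v =
      fderiv ℝ (fderiv ℝ (chartMul E G)) (chartOne E G, chartOne E G) (v, 0) ((0 : E), u)
      - fderiv ℝ (fderiv ℝ (chartMul E G)) (chartOne E G, chartOne E G) (u, 0) ((0 : E), v) := by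
  rw [← neg_sub]
  exact congrArg Neg.neg (bracket_eq (G := G) u v)

end LAEP

/-! ### The structure equation. -/

namespace LAEP

variable {E : Type*} [NormedAddCommGroup E] [NormedSpace ℝ E]
  {G : Type*} [TopologicalSpace G] [ChartedSpace E G] [Group G]
  [LieGroup 𝓘(ℝ, E) ∞ G]

theorem two_le_infty : (2 : ℕ∞ω) ≤ ∞ := WithTop.coe_le_coe.2 (le_top : (2 : ℕ∞) ≤ ⊤)

/-- Since `c τ = (c τ * (c t)⁻¹) * c t`, the coordinate velocity is the first-slot derivative of the
multiplication applied to `ċ c⁻¹`. -/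
theorem deriv_chart_eq {c : ℝ → G} (hc : ContMDiff 𝓘(ℝ, ℝ) 𝓘(ℝ, E) ∞ c) {t : ℝ}
    (ht : c t ∈ (extChartAt 𝓘(ℝ, E) (1 : G)).source)
    (hm : DifferentiableAt ℝ (chartMul E G)
      (chartOne E G, extChartAt 𝓘(ℝ, E) (1 : G) (c t))) :
    fderiv ℝ (chartMul E G) (chartOne E G, extChartAt 𝓘(ℝ, E) (1 : G) (c t))
      (logDeriv E c t, 0) = deriv (fun τ => extChartAt 𝓘(ℝ, E) (1 : G) (c τ)) t := by
  have h3 : ContMDiffAt 𝓘(ℝ, ℝ) 𝓘(ℝ, E) ∞ (fun x : ℝ => c x * (c t)⁻¹) t :=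
    (hc.mul contMDiff_const).contMDiffAt
  have h2 : HasDerivAt (fun x : ℝ => extChartAt 𝓘(ℝ, E) (1 : G) (c x * (c t)⁻¹))
      (logDeriv E c t) t :=
    ((contDiffAt_chart_comp h3 (by simp)).differentiableAt (by simp)).hasDerivAt
  have h4 := hm.hasFDerivAt.comp_hasDerivAt_of_eq t
    (h2.prodMk (hasDerivAt_const t (extChartAt 𝓘(ℝ, E) (1 : G) (c t)))) (by simp [chartOne])
  rw [← h4.deriv]
  refine Filter.EventuallyEq.deriv_eq ?_
  have h6 := h3.continuousAt.preimage_mem_nhds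
    (extChartAt_source_mem_nhds' (I := 𝓘(ℝ, E)) (x := (1 : G)) (x' := c t * (c t)⁻¹) (by simp))
  filter_upwards [h6] with x hx
  simp only [Function.comp_apply, chartMul]
  rw [(extChartAt 𝓘(ℝ, E) (1 : G)).left_inv hx, (extChartAt 𝓘(ℝ, E) (1 : G)).left_inv ht]
  simp

/-- Product rule; the factor in front of the derivative of `W` disappears because the first-slot
derivative at the identity is the identity map. -/
theorem fderiv_fderiv_chartMul {x W : ℝ × ℝ → E} {p : ℝ × ℝ} (hx : DifferentiableAt ℝ x p)
    (hp : x p = chartOne E G) (hW : DifferentiableAt ℝ W p) (d : ℝ × ℝ) :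
    fderiv ℝ (fun q => fderiv ℝ (chartMul E G) (chartOne E G, x q) (W q, 0)) p d =
      fderiv ℝ (fderiv ℝ (chartMul E G)) (chartOne E G, chartOne E G) (0, fderiv ℝ x p d) (W p, 0)
        + fderiv ℝ W p d := by
  have h1 := (((contDiffAt_chartMul E G).fderiv_right (m := ∞) (by simp)).differentiableAt
    (by simp)).hasFDerivAt
  have h2 : HasFDerivAt (fun q => (chartOne E G, x q))
      ((0 : ℝ × ℝ →L[ℝ] E).prod (fderiv ℝ x p)) p :=
    (hasFDerivAt_const _ _).prodMk hx.hasFDerivAt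
  have h3 := HasFDerivAt.comp (f := fun q => (chartOne E G, x q)) p (by rwa [hp]) h2
  have h4 := h3.clm_apply (hW.hasFDerivAt.prodMk (hasFDerivAt_const (0 : E) p))
  have h5 := congrArg (fun T : ℝ × ℝ →L[ℝ] E => T d) h4.fderiv
  simp only [Function.comp_apply, add_apply, ContinuousLinearMap.comp_apply,
    ContinuousLinearMap.flip_apply, ContinuousLinearMap.prod_apply, hp, fderiv_chartMul_fst,
    zero_apply] at h5
  rw [h5, add_comm]

/-- The structure equation `∂_s u - ∂_t η = ad_u η` for `u = γ_t γ⁻¹`, `η = γ_s γ⁻¹`. -/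
theorem maurer_cartan {γ : ℝ → ℝ → G}
    (hγ : ContMDiff 𝓘(ℝ, ℝ × ℝ) 𝓘(ℝ, E) ∞ (fun p : ℝ × ℝ => γ p.1 p.2)) (s t : ℝ) :
    deriv (fun r => logDeriv E (γ r) t) s =
      deriv (fun τ => logDeriv E (fun r => γ r τ) s) t +
        adOp G (logDeriv E (γ s) t) (logDeriv E (fun r => γ r t) s) := by
  -- Right translation by `(γ s t)⁻¹` moves the point of interest to the identity and leaves both
  -- logarithmic derivatives unchanged.
  let x : ℝ × ℝ → E := fun p => extChartAt 𝓘(ℝ, E) (1 : G) (γ p.1 p.2 * (γ s t)⁻¹)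
  let U : ℝ × ℝ → E := fun p => logDeriv E (γ p.1) p.2
  let H : ℝ × ℝ → E := fun p => logDeriv E (fun r => γ r p.2) p.1
  have hk : ContMDiff 𝓘(ℝ, ℝ × ℝ) 𝓘(ℝ, E) ∞ (fun p : ℝ × ℝ => γ p.1 p.2 * (γ s t)⁻¹) :=
    hγ.mul contMDiff_const
  have hx : ContDiffAt ℝ ∞ x (s, t) :=
    contDiffAt_chart_comp (p := (1 : G)) hk.contMDiffAt (by simp)
  have hx0 : x (s, t) = chartOne E G := by simp [x, chartOne]
  have hU : ContDiff ℝ ∞ U := by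
    refine contDiff_logDeriv (F := ℝ × ℝ) (c := fun p => γ p.1) (s := Prod.snd) ?_ contDiff_snd
    exact hγ.comp ((contDiff_fst.comp contDiff_fst).prodMk contDiff_snd).contMDiff
  have hH : ContDiff ℝ ∞ H := by
    refine contDiff_logDeriv (F := ℝ × ℝ) (c := fun p r => γ r p.2) (s := Prod.fst) ?_ contDiff_fst
    exact hγ.comp (contDiff_snd.prodMk (contDiff_snd.comp contDiff_fst)).contMDiff
  have ev : ∀ᶠ p in nhds (s, t), DifferentiableAt ℝ x p ∧
      γ p.1 p.2 * (γ s t)⁻¹ ∈ (extChartAt 𝓘(ℝ, E) (1 : G)).source ∧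
      DifferentiableAt ℝ (chartMul E G) (chartOne E G, x p) := by
    have e1 := (hx.of_le (m := 1) (by simp)).eventually (by simp)
    have e2 := hk.continuous.continuousAt.preimage_mem_nhds (x := (s, t))
      (extChartAt_source_mem_nhds' (I := 𝓘(ℝ, E)) (x := (1 : G)) (x' := γ s t * (γ s t)⁻¹)
        (by simp))
    have e3 := ((contDiffAt_chartMul E G).of_le (m := 1) (by simp)).eventually (by simp)
    have e4 : Filter.Tendsto (fun p => (chartOne E G, x p)) (nhds (s, t))
        (nhds (chartOne E G, chartOne E G)) := by
      have := (continuousAt_const (y := chartOne E G)).prodMk hx.continuousAt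
      rw [← hx0] at this ⊢
      exact this
    filter_upwards [e1, e2, e4.eventually e3] with p h1 h2 h3
    exact ⟨h1.differentiableAt (by simp), h2, h3.differentiableAt (by simp)⟩
  have e1 : (fun p => fderiv ℝ (chartMul E G) (chartOne E G, x p) (U p, 0)) =ᶠ[nhds (s, t)]
      fun p => fderiv ℝ x p (0, 1) := by
    filter_upwards [ev] with p ⟨h1, h2, h3⟩
    rw [← deriv_snd_eq_fderiv h1]
    have hc : ContMDiff 𝓘(ℝ, ℝ) 𝓘(ℝ, E) ∞ (fun τ => γ p.1 τ * (γ s t)⁻¹) :=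
      hk.comp (contDiff_const.prodMk contDiff_id).contMDiff (f := fun τ => (p.1, τ))
    have := deriv_chart_eq hc h2 h3
    rwa [logDeriv_mul_const] at this
  have e2 : (fun p => fderiv ℝ (chartMul E G) (chartOne E G, x p) (H p, 0)) =ᶠ[nhds (s, t)]
      fun p => fderiv ℝ x p (1, 0) := by
    filter_upwards [ev] with p ⟨h1, h2, h3⟩
    rw [← deriv_fst_eq_fderiv h1]
    have hc : ContMDiff 𝓘(ℝ, ℝ) 𝓘(ℝ, E) ∞ (fun τ => γ τ p.2 * (γ s t)⁻¹) :=
      hk.comp (contDiff_id.prodMk contDiff_const).contMDiff (f := fun τ => (τ, p.2))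
    have := deriv_chart_eq hc h2 h3
    rwa [logDeriv_mul_const (fun τ => γ τ p.2)] at this
  have hxd := hx.differentiableAt (by simp)
  have hUd := (hU.differentiable (by simp)) (s, t)
  have hHd := (hH.differentiable (by simp)) (s, t)
  have hx2 := ((hx.fderiv_right (m := ∞) (by simp)).differentiableAt (by simp)).hasFDerivAt
  have hxx : ∀ a b, fderiv ℝ (fun p => fderiv ℝ x p a) (s, t) b =
      fderiv ℝ (fderiv ℝ x) (s, t) b a := by
    intro a b
    have h1 := (hx2.clm_apply (hasFDerivAt_const a (s, t))).fderiv
    simpa using congrArg (fun T : ℝ × ℝ →L[ℝ] E => T b) h1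
  -- Differentiate `∂_t x = ∂₁m(e, x) U` in `s` and `∂_s x = ∂₁m(e, x) H` in `t`, where `m` is the
  -- multiplication in the chart and `e` its identity.
  have f1 := congrArg (fun T : ℝ × ℝ →L[ℝ] E => T (1, 0)) e1.fderiv_eq
  have f2 := congrArg (fun T : ℝ × ℝ →L[ℝ] E => T (0, 1)) e2.fderiv_eq
  simp only [fderiv_fderiv_chartMul hxd hx0 hUd, fderiv_fderiv_chartMul hxd hx0 hHd, hxx] at f1 f2
  have hu : fderiv ℝ x (s, t) (0, 1) = U (s, t) := by
    rw [← e1.eq_of_nhds, hx0, fderiv_chartMul_fst]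
  have hh : fderiv ℝ x (s, t) (1, 0) = H (s, t) := by
    rw [← e2.eq_of_nhds, hx0, fderiv_chartMul_fst]
  rw [hu] at f2
  rw [hh] at f1
  -- Symmetry of `D²x` equates the two right sides; symmetry of `D²m` brings the remaining terms to
  -- the order of slots in `adOp_eq`.
  have sx := (hx.isSymmSndFDerivAt (by simpa using two_le_infty)) (1, 0) (0, 1)
  have sm := (contDiffAt_chartMul E G).isSymmSndFDerivAt (by simpa using two_le_infty)
  rw [sx, ← f2, sm _ (_, 0), sm _ (_, 0)] at f1
  have d1 : deriv (fun r => logDeriv E (γ r) t) s = fderiv ℝ U (s, t) (1, 0) :=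
    deriv_fst_eq_fderiv hUd
  have d2 : deriv (fun τ => logDeriv E (fun r => γ r τ) s) t = fderiv ℝ H (s, t) (0, 1) :=
    deriv_snd_eq_fderiv hHd
  rw [d1, d2, adOp_eq]
  simp only [U, H] at f1 ⊢
  rw [eq_comm, ← sub_eq_iff_eq_add'] at f1
  rw [← f1]
  abel

end LAEP

/-! ### Advected quantities and the Lagrangian in the mean variables. -/

namespace LAEP

section Line

variable {F : Type*} [NormedAddCommGroup F] [NormedSpace ℝ F]
  {F' : Type*} [NormedAddCommGroup F'] [NormedSpace ℝ F']

theorem hasDerivAt_line {f : F → F'} {p : F} (hf : DifferentiableAt ℝ f p) (v : F) :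
    HasDerivAt (fun r : ℝ => f (p + r • v)) (fderiv ℝ f p v) 0 := by
  have h1 : HasDerivAt (fun r : ℝ => p + r • v) v 0 := by
    simpa using ((hasDerivAt_id (0 : ℝ)).smul_const v).const_add p
  exact hf.hasFDerivAt.comp_hasDerivAt_of_eq 0 h1 (by simp)

end Line

variable {E : Type*} [NormedAddCommGroup E] [NormedSpace ℝ E]
  {G : Type*} [TopologicalSpace G] [ChartedSpace E G] [Group G]
  {V : Type*} [NormedAddCommGroup V] [NormedSpace ℝ V]
  {F : Type*} [NormedAddCommGroup F] [NormedSpace ℝ F]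

section Rep

theorem RightRep.act_comp (ρ : RightRep E G V) (g h : G) :
    ρ.act (g * h) = (ρ.act h).comp (ρ.act g) :=
  ContinuousLinearMap.ext fun v => ρ.act_mul g h v

theorem RightRep.act_one_eq (ρ : RightRep E G V) : ρ.act 1 = ContinuousLinearMap.id ℝ V :=
  ContinuousLinearMap.ext fun v => ρ.act_one v

theorem RightRep.advected_eq (ρ : RightRep E G V) (a : StrongDual ℝ V) (c : ℝ → G) (t : ℝ) :
    ρ.advected a c t = a.comp (ρ.act (c t)) := by
  simp [RightRep.advected, RightRep.coact]

theorem RightRep.factorInv_eq (ρ : RightRep E G V) (k : G) (b : StrongDual ℝ V) :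
    ρ.factorInv k b = b.comp (ρ.act k) := by
  simp [RightRep.factorInv, RightRep.coact]

theorem RightRep.contDiff_act (ρ : RightRep E G V) {c : F → G}
    (hc : ContMDiff 𝓘(ℝ, F) 𝓘(ℝ, E) ∞ c) : ContDiff ℝ ∞ (fun x => ρ.act (c x)) :=
  (ρ.smooth.comp hc).contDiff

/-- The infinitesimal generator of `h ↦ h⁻¹` acting on `V`. -/
noncomputable def RightRep.infOp (ρ : RightRep E G V) : E →L[ℝ] V →L[ℝ] V :=
  fderiv ℝ (fun y => ρ.act ((extChartAt 𝓘(ℝ, E) (1 : G)).symm y)⁻¹) (chartOne E G)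

variable [LieGroup 𝓘(ℝ, E) ∞ G]

theorem RightRep.hasFDerivAt_act_inv (ρ : RightRep E G V) :
    HasFDerivAt (fun y => ρ.act ((extChartAt 𝓘(ℝ, E) (1 : G)).symm y)⁻¹) ρ.infOp
      (chartOne E G) := by
  have h := (ρ.smooth.contMDiffAt (x := _)).comp (chartOne E G)
    (contMDiffAt_extChartAt_symm_self (E := E) (1 : G)).inv
  exact (h.contDiffAt.differentiableAt (by simp)).hasFDerivAt

/-- Differentiate `act k ∘ act k⁻¹ = id` at the identity. -/
theorem RightRep.hasFDerivAt_act (ρ : RightRep E G V) :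
    HasFDerivAt (fun y => ρ.act ((extChartAt 𝓘(ℝ, E) (1 : G)).symm y)) (-ρ.infOp)
      (chartOne E G) := by
  have h := (ρ.smooth.contMDiffAt (x := _)).comp (chartOne E G)
    (contMDiffAt_extChartAt_symm_self (E := E) (1 : G))
  have h1 := (h.contDiffAt.differentiableAt (by simp)).hasFDerivAt
  have h2 := h1.clm_comp ρ.hasFDerivAt_act_inv
  have h3 : (fun y => (ρ.act ((extChartAt 𝓘(ℝ, E) (1 : G)).symm y)).comp
      (ρ.act ((extChartAt 𝓘(ℝ, E) (1 : G)).symm y)⁻¹)) =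
      fun _ => ContinuousLinearMap.id ℝ V := by
    funext y
    rw [← ρ.act_comp, inv_mul_cancel, ρ.act_one_eq]
  have h4 := h2.unique (h3 ▸ hasFDerivAt_const _ _)
  have h5 : fderiv ℝ (ρ.act ∘ (extChartAt 𝓘(ℝ, E) (1 : G)).symm) (chartOne E G) = -ρ.infOp := by
    refine ContinuousLinearMap.ext fun v => ContinuousLinearMap.ext fun w => ?_
    have h7 : (extChartAt 𝓘(ℝ, E) (1 : G)).symm (chartOne E G) = 1 := by simp [chartOne]
    simp only [Function.comp_apply, h7, inv_one, ρ.act_one_eq] at h4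
    have h6 := congrArg (fun T : E →L[ℝ] V →L[ℝ] V => T v w) h4
    simpa using eq_neg_of_add_eq_zero_right h6
  rw [← h5]
  exact h1

theorem RightRep.infAct_eq (ρ : RightRep E G V) (a : StrongDual ℝ V)
    (η : GroupLieAlgebra 𝓘(ℝ, E) G) :
    ρ.infAct a η = a.comp (ρ.infOp (show E from η)) := by
  have h1 : ContMDiff 𝓘(ℝ, E) 𝓘(ℝ, StrongDual ℝ V) ∞ (fun h : G => ρ.coact a h) := by
    have h2 : ContMDiff 𝓘(ℝ, E) 𝓘(ℝ, V →L[ℝ] V) ∞ (fun h : G => ρ.act h⁻¹) :=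
      ρ.smooth.comp (contMDiff_inv 𝓘(ℝ, E) ∞)
    exact (ContinuousLinearMap.contMDiff (ContinuousLinearMap.compL ℝ V V ℝ a)).comp h2
  refine (mfderiv_eq_fderiv_symm (h1.mdifferentiable (by simp) 1) η).trans ?_
  have h3 := ((ContinuousLinearMap.compL ℝ V V ℝ a).hasFDerivAt.comp (chartOne E G)
    ρ.hasFDerivAt_act_inv).fderiv
  exact congrArg (fun T : E →L[ℝ] StrongDual ℝ V => T (show E from η)) h3

/-- This is `δã = -ã η`. For a right action, `act (c τ)` is `act (c τ * (c t)⁻¹)` followed by `act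
(c t)`, so only the action near `1` is differentiated. -/
theorem RightRep.hasDerivAt_comp_act (ρ : RightRep E G V) (a : StrongDual ℝ V) {c : ℝ → G} {t : ℝ}
    (hc : ContMDiffAt 𝓘(ℝ, ℝ) 𝓘(ℝ, E) ∞ c t) :
    HasDerivAt (fun τ => a.comp (ρ.act (c τ)))
      (-((a.comp (ρ.act (c t))).comp (ρ.infOp (logDeriv E c t)))) t := by
  have h3 : ContMDiffAt 𝓘(ℝ, ℝ) 𝓘(ℝ, E) ∞ (fun x : ℝ => c x * (c t)⁻¹) t :=
    hc.mul contMDiffAt_const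
  have h2 : HasDerivAt (fun x : ℝ => extChartAt 𝓘(ℝ, E) (1 : G) (c x * (c t)⁻¹))
      (logDeriv E c t) t :=
    ((contDiffAt_chart_comp h3 (by simp)).differentiableAt (by simp)).hasDerivAt
  have h4 := ρ.hasFDerivAt_act.comp_hasDerivAt_of_eq t h2 (by simp [chartOne])
  have h5 := (ContinuousLinearMap.compL ℝ V V ℝ
    (a.comp (ρ.act (c t)))).hasFDerivAt.comp_hasDerivAt t h4
  have h6 : (ContinuousLinearMap.compL ℝ V V ℝ (a.comp (ρ.act (c t))))
      ((-ρ.infOp) (logDeriv E c t)) =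
      -((a.comp (ρ.act (c t))).comp (ρ.infOp (logDeriv E c t))) := by
    ext v; simp
  rw [h6] at h5
  refine h5.congr_of_eventuallyEq ?_
  have h7 := h3.continuousAt.preimage_mem_nhds
    (extChartAt_source_mem_nhds' (I := 𝓘(ℝ, E)) (x := (1 : G)) (x' := c t * (c t)⁻¹) (by simp))
  filter_upwards [h7] with x hx
  simp only [Function.comp_apply, ContinuousLinearMap.compL_apply]
  rw [(extChartAt 𝓘(ℝ, E) (1 : G)).left_inv hx, ContinuousLinearMap.comp_assoc, ← ρ.act_comp]
  simp

end Rep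

section Lagrangian

variable [LieGroup 𝓘(ℝ, E) ∞ G]

variable (E G) in
-- Over the fixed base point `1` the fibre coordinate in the trivialisation at `1` is the identity.
theorem contMDiff_tangent_mk_one :
    ContMDiff 𝓘(ℝ, E) 𝓘(ℝ, E).tangent ∞ (fun u : E => (⟨1, u⟩ : TangentBundle 𝓘(ℝ, E) G)) := by
  intro u
  rw [Bundle.contMDiffAt_totalSpace]
  refine ⟨contMDiffAt_const, ?_⟩
  refine contMDiffAt_id.congr_of_eventuallyEq (Filter.Eventually.of_forall fun w => ?_)
  exact ((tangentBundleCore 𝓘(ℝ, E) G).coordChange_self (achart E (1 : G)) 1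
    (mem_chart_source E (1 : G)) w)

/-- The reduced Lagrangian as a function on `E × V*`. -/
def reducedFun (L : TangentBundle 𝓘(ℝ, E) G → StrongDual ℝ V → ℝ) (q : E × StrongDual ℝ V) : ℝ :=
  reduced L (show GroupLieAlgebra 𝓘(ℝ, E) G from q.1) q.2

theorem contDiff_reducedFun {L : TangentBundle 𝓘(ℝ, E) G → StrongDual ℝ V → ℝ}
    (hL : SmoothLagrangian L) : ContDiff ℝ ∞ (reducedFun L) := by
  rw [← contMDiff_iff_contDiff]
  have h1 : ContMDiff 𝓘(ℝ, E × StrongDual ℝ V) (𝓘(ℝ, E).tangent.prod 𝓘(ℝ, StrongDual ℝ V)) ∞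
      (fun q : E × StrongDual ℝ V => ((⟨1, q.1⟩ : TangentBundle 𝓘(ℝ, E) G), q.2)) :=
    ((contMDiff_tangent_mk_one E G).comp contDiff_fst.contMDiff).prodMk contDiff_snd.contMDiff
  exact hL.comp h1

/-- Right invariance with `h = k⁻¹`. -/
theorem reducedFun_toLieAlgebra {ρ : RightRep E G V}
    {L : TangentBundle 𝓘(ℝ, E) G → StrongDual ℝ V → ℝ} (hinv : RightInvariant ρ L)
    (k : G) (w : TangentSpace 𝓘(ℝ, E) k) (a : StrongDual ℝ V) :
    reducedFun L ((show E from toLieAlgebra w), a.comp (ρ.act k)) = L ⟨k, w⟩ a := by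
  rw [← hinv k k⁻¹ w a]
  have h1 : ρ.coact a k⁻¹ = a.comp (ρ.act k) := by simp [RightRep.coact]
  have h2 : (⟨k * k⁻¹, rightTranslate k⁻¹ w⟩ : TangentBundle 𝓘(ℝ, E) G) = ⟨1, toLieAlgebra w⟩ := by
    -- The base point is generalised before substitution because the type of the fibre component
    -- depends on it.
    have h3 : ∀ (x : G) (v : E), x = 1 →
        (⟨x, v⟩ : TangentBundle 𝓘(ℝ, E) G) = ⟨1, v⟩ := by
      rintro x v rfl; rfl
    exact h3 _ _ (mul_inv_cancel k)
  rw [h1, h2]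
  rfl

theorem fluctuatingLagrangian_eq (ρ : RightRep E G V)
    (L : TangentBundle 𝓘(ℝ, E) G → StrongDual ℝ V → ℝ) {Ξ : ℝ → G}
    (hΞ : ContMDiff 𝓘(ℝ, ℝ) 𝓘(ℝ, E) ∞ Ξ) (p : ℝ × E × StrongDual ℝ V) :
    fluctuatingLagrangian ρ L Ξ p =
      reducedFun L (logDeriv E Ξ p.1 + adjointOp E (Ξ p.1) p.2.1, p.2.2.comp (ρ.act (Ξ p.1))) := by
  have h1 : (show E from toLieAlgebra (velocity E Ξ p.1 + tangentFactor (Ξ p.1) p.2.1)) =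
      logDeriv E Ξ p.1 + adjointOp E (Ξ p.1) p.2.1 := by
    have h2 : (show E from toLieAlgebra (velocity E Ξ p.1 + tangentFactor (Ξ p.1) p.2.1)) =
      (show E from eulerVelocity E Ξ p.1) +
        (show E from toLieAlgebra (tangentFactor (Ξ p.1) p.2.1)) := by
      exact map_add (mfderiv 𝓘(ℝ, E) 𝓘(ℝ, E) (fun x : G => x * (Ξ p.1)⁻¹) (Ξ p.1)) _ _
    rw [h2]
    exact congrArg₂ (· + ·) (eulerVelocity_eq_logDeriv (hΞ.mdifferentiable (by simp) _))
      (toLieAlgebra_tangentFactor _ _)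
  rw [← h1, ← ρ.factorInv_eq]
  rfl

theorem contDiff_fluctuatingLagrangian (ρ : RightRep E G V)
    {L : TangentBundle 𝓘(ℝ, E) G → StrongDual ℝ V → ℝ} (hL : SmoothLagrangian L) {Ξ : ℝ → G}
    (hΞ : ContMDiff 𝓘(ℝ, ℝ) 𝓘(ℝ, E) ∞ Ξ) : ContDiff ℝ ∞ (fluctuatingLagrangian ρ L Ξ) := by
  rw [funext (fluctuatingLagrangian_eq ρ L hΞ)]
  have h1 : ContDiff ℝ ∞ (fun t => logDeriv E Ξ t) :=
    contDiff_logDeriv (F := ℝ) (c := fun _ => Ξ) (s := id) (hΞ.comp contDiff_snd.contMDiff)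
      contDiff_id
  have h2 := contDiff_adjointOp hΞ
  have h3 := ρ.contDiff_act hΞ
  refine (contDiff_reducedFun hL).comp (ContDiff.prodMk ?_ ?_)
  · exact (h1.comp contDiff_fst).add ((h2.comp contDiff_fst).clm_apply
      (contDiff_fst.comp contDiff_snd))
  · exact (contDiff_snd.comp contDiff_snd).clm_comp (h3.comp contDiff_fst)

/-- Invariance reduces the left side to the Eulerian velocity of `Ξ c`, which the product rule
splits into that of `Ξ` plus the adjoint image of that of `c`. This separates the random part from
the varied curve. -/
theorem lagrangian_lift_glm {ρ : RightRep E G V}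
    {L : TangentBundle 𝓘(ℝ, E) G → StrongDual ℝ V → ℝ} (hinv : RightInvariant ρ L)
    (a : StrongDual ℝ V) {Ξ c : ℝ → G} (hΞ : ContMDiff 𝓘(ℝ, ℝ) 𝓘(ℝ, E) ∞ Ξ)
    (hc : ContMDiff 𝓘(ℝ, ℝ) 𝓘(ℝ, E) ∞ c) (t : ℝ) :
    L (lift E (glm Ξ c) t) a =
      fluctuatingLagrangian ρ L Ξ (t, logDeriv E c t, a.comp (ρ.act (c t))) := by
  have hg : ContMDiff 𝓘(ℝ, ℝ) 𝓘(ℝ, E) ∞ (glm Ξ c) := hΞ.mul hc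
  refine (reducedFun_toLieAlgebra hinv (glm Ξ c t) (velocity E (glm Ξ c) t) a).symm.trans ?_
  rw [fluctuatingLagrangian_eq ρ L hΞ]
  have h1 : (show E from toLieAlgebra (velocity E (glm Ξ c) t)) =
      logDeriv E Ξ t + adjointOp E (Ξ t) (logDeriv E c t) :=
    (eulerVelocity_eq_logDeriv (hg.mdifferentiable (by simp) _)).trans (logDeriv_mul hΞ hc t)
  rw [h1, ContinuousLinearMap.comp_assoc, ← ρ.act_comp]
  rfl

end Lagrangian

end LAEP

/-! ### Variational derivatives of `ℓ` as partial derivatives in the mean variables. -/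

namespace LAEP

variable {E : Type*} [NormedAddCommGroup E] [NormedSpace ℝ E]
  {G : Type*} [TopologicalSpace G] [ChartedSpace E G] [Group G]
  {V : Type*} [NormedAddCommGroup V] [NormedSpace ℝ V]
  [LieGroup 𝓘(ℝ, E) ∞ G]

/-- Right translation by `g⁻¹` and then by `Ξ⁻¹` is right translation by `(Ξ g)⁻¹`, so the product
rule applies. -/
theorem toLieAlgebra_uXi {Ξ g : ℝ → G} (hΞ : ContMDiff 𝓘(ℝ, ℝ) 𝓘(ℝ, E) ∞ Ξ)
    (hg : ContMDiff 𝓘(ℝ, ℝ) 𝓘(ℝ, E) ∞ g) (t : ℝ) :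
    (show E from toLieAlgebra (uXi E Ξ g t)) =
      logDeriv E Ξ t + adjointOp E (Ξ t) (logDeriv E g t) := by
  have hc : MDifferentiableAt 𝓘(ℝ, ℝ) 𝓘(ℝ, E) (glm Ξ g) t :=
    (hΞ.mul hg).mdifferentiable (by simp) t
  have h1 := mdifferentiableAt_mul_right E (g t)⁻¹ (Ξ t * g t)
  have h2 := mdifferentiableAt_mul_right E (Ξ t)⁻¹ (Ξ t)
  have hb : Ξ t * g t * (g t)⁻¹ = Ξ t := by simp
  have e1 : (show E from uXi E Ξ g t) =
      mfderiv 𝓘(ℝ, ℝ) 𝓘(ℝ, E) ((fun x : G => x * (g t)⁻¹) ∘ glm Ξ g) t (1 : ℝ) :=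
    (mfderiv_comp_apply t h1 hc (1 : ℝ)).symm
  have e2 : (show E from toLieAlgebra (uXi E Ξ g t)) =
      mfderiv 𝓘(ℝ, ℝ) 𝓘(ℝ, E) ((fun x : G => x * (Ξ t)⁻¹) ∘ (fun x : G => x * (g t)⁻¹) ∘ glm Ξ g) t
        (1 : ℝ) := by
    have h3 := mfderiv_comp_apply_of_eq (f := (fun x : G => x * (g t)⁻¹) ∘ glm Ξ g) t h2
      (h1.comp t hc) hb (1 : ℝ)
    refine Eq.trans ?_ h3.symm
    exact congrArg (fun w : E => (show E from mfderiv 𝓘(ℝ, E) 𝓘(ℝ, E)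
      (fun x : G => x * (Ξ t)⁻¹) (Ξ t) w)) e1
  have h2' : MDifferentiableAt 𝓘(ℝ, E) 𝓘(ℝ, E) (fun x : G => x * (Ξ t)⁻¹)
      (((fun x : G => x * (g t)⁻¹) ∘ glm Ξ g) t) := mdifferentiableAt_mul_right E _ _
  have e3 := mfderiv_eq_fderiv_chart (p := (1 : G)) (h2'.comp t (h1.comp t hc))
    (by simp [glm]) (1 : ℝ)
  rw [← logDeriv_mul hΞ hg]
  refine (e2.trans e3).trans ?_
  rw [logDeriv, ← fderiv_apply_one_eq_deriv]
  simp only [Function.comp_apply, glm, mul_inv_rev, mul_assoc]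

theorem reducedAt_eq (L : TangentBundle 𝓘(ℝ, E) G → StrongDual ℝ V → ℝ) {k : G}
    (w : TangentSpace 𝓘(ℝ, E) k) (b : StrongDual ℝ V) :
    reducedAt L w b = reducedFun L ((show E from toLieAlgebra w), b) := rfl

theorem toLieAlgebra_uXi_add {Ξ g : ℝ → G} (hΞ : ContMDiff 𝓘(ℝ, ℝ) 𝓘(ℝ, E) ∞ Ξ)
    (hg : ContMDiff 𝓘(ℝ, ℝ) 𝓘(ℝ, E) ∞ g) (t : ℝ) (ε : ℝ) (w : GroupLieAlgebra 𝓘(ℝ, E) G) :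
    (show E from toLieAlgebra (uXi E Ξ g t + ε • tangentFactor (Ξ t) w)) =
      logDeriv E Ξ t + adjointOp E (Ξ t) (logDeriv E g t + ε • (show E from w)) := by
  let T := mfderiv 𝓘(ℝ, E) 𝓘(ℝ, E) (fun x : G => x * (Ξ t)⁻¹) (Ξ t)
  have h1 : (show E from toLieAlgebra (uXi E Ξ g t + ε • tangentFactor (Ξ t) w)) =
      (show E from toLieAlgebra (uXi E Ξ g t)) +
        ε • (show E from toLieAlgebra (tangentFactor (Ξ t) w)) :=
    (map_add T _ _).trans (congrArg (fun x : E => (show E from T (uXi E Ξ g t)) + x)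
      (map_smul T ε (tangentFactor (Ξ t) w)))
  have h2 : (show E from toLieAlgebra (tangentFactor (Ξ t) w)) = adjointOp E (Ξ t) w :=
    toLieAlgebra_tangentFactor (Ξ t) w
  rw [h1, toLieAlgebra_uXi hΞ hg, h2, map_add, map_smul, add_assoc]

/-- Two independent parameters serve both the partial derivatives (one of them zero) and the joint
constrained variation (`ε = δ`). -/
theorem reducedAt_variation (ρ : RightRep E G V)
    (L : TangentBundle 𝓘(ℝ, E) G → StrongDual ℝ V → ℝ) (a₀ : StrongDual ℝ V) {Ξ g : ℝ → G}
    (hΞ : ContMDiff 𝓘(ℝ, ℝ) 𝓘(ℝ, E) ∞ Ξ)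
    (hg : ContMDiff 𝓘(ℝ, ℝ) 𝓘(ℝ, E) ∞ g) (t ε δ : ℝ) (w : GroupLieAlgebra 𝓘(ℝ, E) G)
    (b : StrongDual ℝ V) :
    reducedAt L (uXi E Ξ g t + ε • tangentFactor (Ξ t) w)
      (ρ.aXi a₀ Ξ g t + δ • ρ.factorInv (Ξ t) b) =
    fluctuatingLagrangian ρ L Ξ
      (t, logDeriv E g t + ε • (show E from w), a₀.comp (ρ.act (g t)) + δ • b) := by
  rw [reducedAt_eq, toLieAlgebra_uXi_add hΞ hg, fluctuatingLagrangian_eq ρ L hΞ, RightRep.aXi,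
    ρ.factorInv_eq, ρ.factorInv_eq, ρ.advected_eq, ContinuousLinearMap.add_comp,
    ContinuousLinearMap.smul_comp]

/-- Both sides are derivatives at `r = 0` of one function of `r`, read first on `T_Ξ G` and then on
the mean variables. -/
theorem derivVelocity_tangentFactor (ρ : RightRep E G V)
    {L : TangentBundle 𝓘(ℝ, E) G → StrongDual ℝ V → ℝ} (hL : SmoothLagrangian L)
    (a₀ : StrongDual ℝ V) {Ξ g : ℝ → G} (hΞ : ContMDiff 𝓘(ℝ, ℝ) 𝓘(ℝ, E) ∞ Ξ)
    (hg : ContMDiff 𝓘(ℝ, ℝ) 𝓘(ℝ, E) ∞ g) (t : ℝ) (η : E) :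
    derivVelocity L (uXi E Ξ g t) (ρ.aXi a₀ Ξ g t) (tangentFactor (Ξ t) η) =
      fderiv ℝ (fluctuatingLagrangian ρ L Ξ) (t, logDeriv E g t, a₀.comp (ρ.act (g t)))
        (0, η, 0) := by
  let T : E →L[ℝ] E := mfderiv 𝓘(ℝ, E) 𝓘(ℝ, E) (fun x : G => x * (Ξ t)⁻¹) (Ξ t)
  let w₀ : E := uXi E Ξ g t
  let v : E := tangentFactor (Ξ t) η
  have hd : Differentiable ℝ (fun w : E => reducedFun L (T w, ρ.aXi a₀ Ξ g t)) :=
    ((contDiff_reducedFun hL).differentiable (by simp)).comp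
      (T.differentiable.prodMk (differentiable_const _))
  have h1 := hasDerivAt_line (hd w₀) v
  have h2 := hasDerivAt_line ((contDiff_fluctuatingLagrangian ρ hL hΞ).differentiable (by simp)
    (t, logDeriv E g t, a₀.comp (ρ.act (g t)))) ((0 : ℝ), η, (0 : StrongDual ℝ V))
  refine h1.unique (h2.congr_of_eventuallyEq (Filter.Eventually.of_forall fun r => ?_))
  have h3 := reducedAt_variation ρ L a₀ hΞ hg t r 0 η 0
  simp only [zero_smul, add_zero] at h3
  have h4 : (t, logDeriv E g t, a₀.comp (ρ.act (g t))) +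
      r • ((0 : ℝ), η, (0 : StrongDual ℝ V)) =
      (t, logDeriv E g t + r • η, a₀.comp (ρ.act (g t))) := by
    simp only [Prod.smul_mk, Prod.mk_add_mk, smul_zero, add_zero]
  exact h3.trans (congrArg (fluctuatingLagrangian ρ L Ξ) h4.symm)

theorem derivAdvected_factorInv (ρ : RightRep E G V)
    {L : TangentBundle 𝓘(ℝ, E) G → StrongDual ℝ V → ℝ} (hL : SmoothLagrangian L)
    (a₀ : StrongDual ℝ V) {Ξ g : ℝ → G} (hΞ : ContMDiff 𝓘(ℝ, ℝ) 𝓘(ℝ, E) ∞ Ξ)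
    (hg : ContMDiff 𝓘(ℝ, ℝ) 𝓘(ℝ, E) ∞ g) (t : ℝ) (α : StrongDual ℝ V) :
    derivAdvected L (uXi E Ξ g t) (ρ.aXi a₀ Ξ g t) (ρ.factorInv (Ξ t) α) =
      fderiv ℝ (fluctuatingLagrangian ρ L Ξ) (t, logDeriv E g t, a₀.comp (ρ.act (g t)))
        (0, 0, α) := by
  let w₀ : E := toLieAlgebra (uXi E Ξ g t)
  have hd : Differentiable ℝ (fun b : StrongDual ℝ V => reducedFun L (w₀, b)) :=
    ((contDiff_reducedFun hL).differentiable (by simp)).comp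
      ((differentiable_const _).prodMk differentiable_id)
  have h1 := hasDerivAt_line (hd (ρ.aXi a₀ Ξ g t)) (ρ.factorInv (Ξ t) α)
  have h2 := hasDerivAt_line ((contDiff_fluctuatingLagrangian ρ hL hΞ).differentiable (by simp)
    (t, logDeriv E g t, a₀.comp (ρ.act (g t)))) ((0 : ℝ), (0 : E), α)
  refine h1.unique (h2.congr_of_eventuallyEq (Filter.Eventually.of_forall fun r => ?_))
  have h3 := reducedAt_variation ρ L a₀ hΞ hg t 0 r (0 : E) α
  simp only [zero_smul, add_zero] at h3
  have h4 : (t, logDeriv E g t, a₀.comp (ρ.act (g t))) + r • ((0 : ℝ), (0 : E), α) =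
      (t, logDeriv E g t, a₀.comp (ρ.act (g t)) + r • α) := by
    simp only [Prod.smul_mk, Prod.mk_add_mk, smul_zero, add_zero]
  exact h3.trans (congrArg (fluctuatingLagrangian ρ L Ξ) h4.symm)

end LAEP

/-! ### Differentiation under the mean. -/

namespace LAEP

section Dominated

variable {Ω : Type*} [MeasurableSpace Ω] {μ : Measure Ω}

/-- A random continuous function that is dominated on every compact set by an integrable random
variable. -/
structure DominatedFamily (μ : Measure Ω) {Y : Type*} [TopologicalSpace Y] (h : Ω → Y → ℝ) :
    Prop where
  meas : ∀ y, AEStronglyMeasurable (fun σ => h σ y) μ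
  cont : ∀ σ, Continuous (h σ)
  bound : ∀ C : Set Y, IsCompact C → ∃ B : Ω → ℝ, Integrable B μ ∧ ∀ᵐ σ ∂μ, ∀ y ∈ C, ‖h σ y‖ ≤ B σ

namespace DominatedFamily

variable {Y Z : Type*} [TopologicalSpace Y] [TopologicalSpace Z] {h h' : Ω → Y → ℝ}

theorem comp (hh : DominatedFamily μ h) {φ : Z → Y} (hφ : Continuous φ) :
    DominatedFamily μ (fun σ z => h σ (φ z)) where
  meas z := hh.meas (φ z)
  cont σ := (hh.cont σ).comp hφ
  bound C hC := by
    obtain ⟨B, hB, hb⟩ := hh.bound (φ '' C) (hC.image hφ)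
    exact ⟨B, hB, hb.mono fun σ hσ z hz => hσ _ (Set.mem_image_of_mem φ hz)⟩

theorem add (hh : DominatedFamily μ h) (hh' : DominatedFamily μ h') :
    DominatedFamily μ (fun σ y => h σ y + h' σ y) where
  meas y := (hh.meas y).add (hh'.meas y)
  cont σ := (hh.cont σ).add (hh'.cont σ)
  bound C hC := by
    obtain ⟨B, hB, hb⟩ := hh.bound C hC
    obtain ⟨B', hB', hb'⟩ := hh'.bound C hC
    refine ⟨fun σ => B σ + B' σ, hB.add hB', ?_⟩
    filter_upwards [hb, hb'] with σ h1 h2 y hy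
    exact (norm_add_le _ _).trans (add_le_add (h1 y hy) (h2 y hy))

theorem integrable (hh : DominatedFamily μ h) (y : Y) : Integrable (fun σ => h σ y) μ := by
  obtain ⟨B, hB, hb⟩ := hh.bound {y} isCompact_singleton
  exact hB.mono' (hh.meas y) (hb.mono fun σ hσ => hσ y rfl)

/-- Dominated convergence needs a bound on a neighbourhood, while bounds are given on compact sets.
Hence the parameter space is locally compact, and functions on the possibly infinite-dimensional `F`
are first restricted along maps from such spaces. -/
theorem continuous_mean [LocallyCompactSpace Y] [FirstCountableTopology Y]
    (hh : DominatedFamily μ h) : Continuous (fun y => ∫ σ, h σ y ∂μ) := by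
  refine continuous_iff_continuousAt.2 fun y => ?_
  obtain ⟨K, hK, hy⟩ := exists_compact_mem_nhds y
  obtain ⟨B, hB, hb⟩ := hh.bound K hK
  refine continuousAt_of_dominated (bound := B) (Filter.Eventually.of_forall hh.meas) ?_ hB
    (Filter.Eventually.of_forall fun σ => (hh.cont σ).continuousAt)
  filter_upwards [hy] with z hz
  filter_upwards [hb] with σ hσ using hσ z hz

theorem hasDerivAt_mean {h h' : Ω → ℝ → ℝ} (hh : DominatedFamily μ h) (hh' : DominatedFamily μ h')
    (hd : ∀ σ x, HasDerivAt (h σ) (h' σ x) x) (x : ℝ) :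
    HasDerivAt (fun x => ∫ σ, h σ x ∂μ) (∫ σ, h' σ x ∂μ) x := by
  obtain ⟨K, hK, hy⟩ := exists_compact_mem_nhds x
  obtain ⟨B, hB, hb⟩ := hh'.bound K hK
  exact (hasDerivAt_integral_of_dominated_loc_of_deriv_le (F := fun x σ => h σ x)
    (F' := fun x σ => h' σ x) hy (Filter.Eventually.of_forall hh.meas) (hh.integrable x)
    (hh'.meas x) hb hB (Filter.Eventually.of_forall fun σ y _ => hd σ y)).2

end DominatedFamily

theorem hasDerivAt_intervalIntegral_of_continuous {Φ Ψ : ℝ × ℝ → ℝ} (hΦ : Continuous Φ)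
    (hΨ : Continuous Ψ) (hd : ∀ s t, HasDerivAt (fun r => Φ (r, t)) (Ψ (s, t)) s) (a b s : ℝ) :
    HasDerivAt (fun r => ∫ t in a..b, Φ (r, t)) (∫ t in a..b, Ψ (s, t)) s := by
  obtain ⟨C, hC⟩ := (isCompact_Icc (a := s - 1) (b := s + 1)).prod
    (isCompact_uIcc (a := a) (b := b)) |>.exists_bound_of_continuousOn hΨ.continuousOn
  refine (intervalIntegral.hasDerivAt_integral_of_dominated_loc_of_deriv_le (bound := fun _ => C)
    (F := fun r t => Φ (r, t)) (F' := fun r t => Ψ (r, t))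
    (Icc_mem_nhds (by linarith) (by linarith) : Set.Icc (s - 1) (s + 1) ∈ nhds s) ?_ ?_ ?_ ?_ ?_ ?_).2
  · exact Filter.Eventually.of_forall fun r =>
      (hΦ.comp (Continuous.prodMk_right r)).aestronglyMeasurable
  · exact (hΦ.comp (Continuous.prodMk_right s)).intervalIntegrable _ _
  · exact (hΨ.comp (Continuous.prodMk_right s)).aestronglyMeasurable
  · exact Filter.Eventually.of_forall fun t ht r hr =>
      hC (r, t) ⟨hr, Set.uIoc_subset_uIcc ht⟩
  · exact intervalIntegrable_const
  · exact Filter.Eventually.of_forall fun t _ r _ => hd r t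

variable {F : Type*} [NormedAddCommGroup F] [NormedSpace ℝ F]

/-- A directional derivative is a limit of difference quotients, each measurable in `σ`. -/
theorem aestronglyMeasurable_fderiv_apply {h : Ω → F → ℝ} {p : F}
    (hm : ∀ q, AEStronglyMeasurable (fun σ => h σ q) μ) (hd : ∀ σ, DifferentiableAt ℝ (h σ) p)
    (v : F) : AEStronglyMeasurable (fun σ => fderiv ℝ (h σ) p v) μ := by
  have h1 : ∀ σ, Filter.Tendsto (fun r : ℝ => r⁻¹ • (h σ (p + r • v) - h σ p))
      (nhdsWithin 0 {0}ᶜ) (nhds (fderiv ℝ (h σ) p v)) := by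
    intro σ
    have := (hasDerivAt_line (hd σ) v).tendsto_slope_zero
    simpa using this
  exact aestronglyMeasurable_of_tendsto_ae (nhdsWithin (0 : ℝ) {0}ᶜ)
    (f := fun (r : ℝ) σ => r⁻¹ • (h σ (p + r • v) - h σ p))
    (fun r => ((hm (p + r • v)).sub (hm p)).const_smul r⁻¹)
    (Filter.Eventually.of_forall h1)

variable {f : Ω → F → ℝ}

theorem DominatedC2.exists_bound (hdom : DominatedC2 μ f) {K : Set F} (hK : IsCompact K) :
    ∃ B : Ω → ℝ, Integrable B μ ∧ ∀ᵐ σ ∂μ, 0 ≤ B σ ∧ ∀ p ∈ K, ‖f σ p‖ ≤ B σ ∧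
      ‖fderiv ℝ (f σ) p‖ ≤ B σ ∧ ‖fderiv ℝ (fderiv ℝ (f σ)) p‖ ≤ B σ := by
  obtain ⟨B, hB, hb⟩ := hdom.2 K hK
  -- The absolute value makes the bound nonnegative even when `K` is empty.
  refine ⟨fun σ => ‖B σ‖, hB.norm, hb.mono fun σ hσ => ⟨norm_nonneg _, fun p hp => ?_⟩⟩
  have h := fun k hk => (hσ p hp k hk).trans (Real.le_norm_self _)
  refine ⟨?_, ?_, ?_⟩
  · simpa using h 0 (by norm_num)
  · have := h 1 (by norm_num)
    rwa [← zero_add 1, ← norm_iteratedFDeriv_fderiv, norm_iteratedFDeriv_zero] at this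
  · have := h 2 le_rfl
    rwa [← one_add_one_eq_two, ← norm_iteratedFDeriv_fderiv, ← zero_add 1,
      ← norm_iteratedFDeriv_fderiv, norm_iteratedFDeriv_zero] at this

variable {Y : Type*} [TopologicalSpace Y]

theorem DominatedC2.family (hdom : DominatedC2 μ f) (hf : ∀ σ, ContDiff ℝ ∞ (f σ)) {p : Y → F}
    (hp : Continuous p) : DominatedFamily μ (fun σ y => f σ (p y)) where
  meas y := hdom.1 _
  cont σ := (hf σ).continuous.comp hp
  bound C hC := by
    obtain ⟨B, hB, hb⟩ := hdom.exists_bound (hC.image hp)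
    exact ⟨B, hB, hb.mono fun σ hσ y hy => (hσ.2 _ (Set.mem_image_of_mem p hy)).1⟩

theorem DominatedC2.family_fderiv (hdom : DominatedC2 μ f) (hf : ∀ σ, ContDiff ℝ ∞ (f σ))
    {p v : Y → F} (hp : Continuous p) (hv : Continuous v) :
    DominatedFamily μ (fun σ y => fderiv ℝ (f σ) (p y) (v y)) where
  meas y := aestronglyMeasurable_fderiv_apply hdom.1
    (fun σ => (hf σ).differentiable (by simp) _) _
  cont σ := (((hf σ).continuous_fderiv (by simp)).comp hp).clm_apply hv
  bound C hC := by
    obtain ⟨B, hB, hb⟩ := hdom.exists_bound (hC.image hp)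
    obtain ⟨c, hc⟩ := hC.exists_bound_of_continuousOn hv.continuousOn
    refine ⟨fun σ => B σ * c, hB.mul_const c, hb.mono fun σ hσ y hy => ?_⟩
    exact ((fderiv ℝ (f σ) (p y)).le_opNorm _).trans
      (mul_le_mul (hσ.2 _ (Set.mem_image_of_mem p hy)).2.1 (hc y hy) (norm_nonneg _) hσ.1)

theorem DominatedC2.family_fderiv_fderiv (hdom : DominatedC2 μ f) (hf : ∀ σ, ContDiff ℝ ∞ (f σ))
    {p v w : Y → F} (hp : Continuous p) (hv : Continuous v) (hw : Continuous w) :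
    DominatedFamily μ (fun σ y => fderiv ℝ (fderiv ℝ (f σ)) (p y) (v y) (w y)) where
  meas y := by
    have hd : ∀ σ q, DifferentiableAt ℝ (fderiv ℝ (f σ)) q := fun σ q =>
      ((hf σ).fderiv_right (m := ∞) (by simp)).differentiable (by simp) q
    -- As a directional derivative of a directional derivative, the second derivative inherits
    -- measurability by using difference quotients twice.
    have h1 : ∀ σ, fderiv ℝ (fderiv ℝ (f σ)) (p y) (v y) (w y) =
        fderiv ℝ (fun q => fderiv ℝ (f σ) q (w y)) (p y) (v y) := by
      intro σ
      have h2 := ((hd σ (p y)).hasFDerivAt.clm_apply (hasFDerivAt_const (w y) (p y))).fderiv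
      simpa using (congrArg (fun T : F →L[ℝ] ℝ => T (v y)) h2).symm
    simp_rw [h1]
    exact aestronglyMeasurable_fderiv_apply
      (fun q => aestronglyMeasurable_fderiv_apply hdom.1
        (fun σ => (hf σ).differentiable (by simp) _) _)
      (fun σ => (hd σ (p y)).clm_apply (differentiableAt_const _)) _
  cont σ := (((((hf σ).fderiv_right (m := ∞) (by simp)).continuous_fderiv (by simp)).comp
    hp).clm_apply hv).clm_apply hw
  bound C hC := by
    obtain ⟨B, hB, hb⟩ := hdom.exists_bound (hC.image hp)
    obtain ⟨c, hc⟩ := hC.exists_bound_of_continuousOn hv.continuousOn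
    obtain ⟨d, hd⟩ := hC.exists_bound_of_continuousOn hw.continuousOn
    refine ⟨fun σ => B σ * c * d, (hB.mul_const c).mul_const d, hb.mono fun σ hσ y hy => ?_⟩
    have h1 : 0 ≤ c := (norm_nonneg _).trans (hc y hy)
    refine ((fderiv ℝ (fderiv ℝ (f σ)) (p y)).le_opNorm₂ _ _).trans ?_
    have h2 := (hσ.2 _ (Set.mem_image_of_mem p hy)).2.2
    have h3 := hc y hy
    have h4 := hd y hy
    have h5 := hσ.1
    beta_reduce
    gcongr

/-- The first variation of a mean action. -/
theorem DominatedC2.hasDerivAt_action (hdom : DominatedC2 μ f) (hf : ∀ σ, ContDiff ℝ ∞ (f σ))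
    {p : ℝ × ℝ → F} (hp : ContDiff ℝ ∞ p) (a b s : ℝ) :
    HasDerivAt (fun r => ∫ t in a..b, ∫ σ, f σ (p (r, t)) ∂μ)
      (∫ t in a..b, ∫ σ, fderiv ℝ (f σ) (p (s, t)) (deriv (fun r => p (r, t)) s) ∂μ) s := by
  have hpd : Differentiable ℝ p := hp.differentiable (by simp)
  have hv : Continuous (fun q => fderiv ℝ p q (1, 0)) :=
    (hp.continuous_fderiv (by simp)).clm_apply continuous_const
  have h1 : ∀ s t, deriv (fun r => p (r, t)) s = fderiv ℝ p (s, t) (1, 0) :=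
    fun s t => deriv_fst_eq_fderiv (hpd (s, t))
  simp_rw [h1]
  have hD := hdom.family_fderiv hf hp.continuous hv
  refine hasDerivAt_intervalIntegral_of_continuous
    (Φ := fun q => ∫ σ, f σ (p q) ∂μ)
    (Ψ := fun q => ∫ σ, fderiv ℝ (f σ) (p q) (fderiv ℝ p q (1, 0)) ∂μ)
    (hdom.family hf hp.continuous).continuous_mean hD.continuous_mean (fun s t => ?_) a b s
  have hc : Continuous (fun r : ℝ => (r, t)) := Continuous.prodMk_left t
  refine DominatedFamily.hasDerivAt_mean (hdom.family hf (hp.continuous.comp hc))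
    (hD.comp hc) (fun σ x => ?_) s
  have h2 : HasDerivAt (fun r => p (r, t)) (fderiv ℝ p (x, t) (1, 0)) x := by
    rw [← h1]
    exact (hpd.comp ((differentiable_id).prodMk (differentiable_const t)) x).hasDerivAt
  exact ((hf σ).differentiable (by simp) _).hasFDerivAt.comp_hasDerivAt x h2

theorem hasDerivAt_fderiv_apply {f : F → ℝ} {p v : ℝ → F} {p' v' : F}
    {t : ℝ} (hf : ContDiffAt ℝ ∞ f (p t)) (hp : HasDerivAt p p' t) (hv : HasDerivAt v v' t) :
    HasDerivAt (fun τ => fderiv ℝ f (p τ) (v τ))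
      (fderiv ℝ (fderiv ℝ f) (p t) p' (v t) + fderiv ℝ f (p t) v') t := by
  have hd : DifferentiableAt ℝ (fderiv ℝ f) (p t) :=
    (hf.fderiv_right (m := ∞) (by simp)).differentiableAt (by simp)
  exact (hd.hasFDerivAt.comp_hasDerivAt t hp).clm_apply hv

/-- The time derivative of a mean momentum; this is where the bounds on second derivatives are
needed. -/
theorem DominatedC2.hasDerivAt_mean_fderiv (hdom : DominatedC2 μ f)
    (hf : ∀ σ, ContDiff ℝ ∞ (f σ)) {p v : ℝ → F} (hp : ContDiff ℝ ∞ p) (hv : ContDiff ℝ ∞ v)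
    (t : ℝ) :
    HasDerivAt (fun τ => ∫ σ, fderiv ℝ (f σ) (p τ) (v τ) ∂μ)
      (∫ σ, (fderiv ℝ (fderiv ℝ (f σ)) (p t) (deriv p t) (v t)
        + fderiv ℝ (f σ) (p t) (deriv v t)) ∂μ) t := by
  have hp' := hp.continuous_deriv (by simp)
  have hv' := hv.continuous_deriv (by simp)
  refine DominatedFamily.hasDerivAt_mean (hdom.family_fderiv hf hp.continuous hv.continuous)
    ((hdom.family_fderiv_fderiv hf hp.continuous hp' hv.continuous).add
      (hdom.family_fderiv hf hp.continuous hv')) (fun σ x => ?_) t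
  exact hasDerivAt_fderiv_apply (hf σ).contDiffAt ((hp.differentiable (by simp)) x).hasDerivAt
    ((hv.differentiable (by simp)) x).hasDerivAt

end Dominated

end LAEP

/-! ### The Euler–Lagrange expression in coordinates. -/

namespace LAEP

section Abstract

variable {E : Type*} [NormedAddCommGroup E] [NormedSpace ℝ E]
  {F : Type*} [NormedAddCommGroup F] [NormedSpace ℝ F]

theorem deriv_fderiv_apply_sub {Λ : E × E → ℝ} {Q : ℝ → E × E} {Q' : E × E} {b : ℝ → E} {b' : E}
    {t : ℝ} (hΛ : ContDiffAt ℝ ∞ Λ (Q t)) (hQ : HasDerivAt Q Q' t) (hb : HasDerivAt b b' t) :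
    deriv (fun τ => fderiv ℝ Λ (Q τ) (0, b τ)) t =
      deriv (fun τ => fderiv ℝ Λ (Q τ) (0, b t)) t + fderiv ℝ Λ (Q t) (0, b') := by
  have h1 := hasDerivAt_fderiv_apply hΛ hQ ((hasDerivAt_const t (0 : E)).prodMk hb)
  have h2 := hasDerivAt_fderiv_apply hΛ hQ (hasDerivAt_const t ((0 : E), b t))
  rw [h1.deriv, h2.deriv, map_zero, add_zero]

/-- Integration by parts in the first variation, in coordinates. -/
theorem eulerLagrange_coordinates {Λ : E × E → ℝ} {y : ℝ × ℝ → E} {t : ℝ}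
    (hy : ContDiffAt ℝ ∞ y (0, t)) {Q : ℝ × ℝ → E × E} (hQ : Q = fun p => (y p, fderiv ℝ y p (0, 1)))
    (hΛ : ContDiffAt ℝ ∞ Λ (Q (0, t)))
    {f : F → ℝ} (hf : ContDiff ℝ ∞ f) {P : ℝ × ℝ → F} (hP : ContDiff ℝ ∞ P) {v : F}
    (h1 : ∀ᶠ s in nhds (0 : ℝ), Λ (Q (s, t)) = f (P (s, t)))
    (h2 : ∀ᶠ τ in nhds t, fderiv ℝ Λ (Q (0, τ)) (0, fderiv ℝ y (0, τ) (1, 0)) =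
      fderiv ℝ f (P (0, τ)) v) :
    fderiv ℝ Λ (Q (0, t)) (fderiv ℝ y (0, t) (1, 0), 0)
      - deriv (fun τ => fderiv ℝ Λ (Q (0, τ)) (0, fderiv ℝ y (0, t) (1, 0))) t =
    fderiv ℝ f (P (0, t)) (deriv (fun s => P (s, t)) 0)
      - deriv (fun τ => fderiv ℝ f (P (0, τ)) v) t := by
  have hy' := hy.fderiv_right (m := ∞) (by simp)
  have hyd := (hy.differentiableAt (by simp)).hasFDerivAt
  have hy2 := (hy'.differentiableAt (by simp)).hasFDerivAt
  have hQd := hyd.prodMk (hy2.clm_apply (hasFDerivAt_const ((0 : ℝ), (1 : ℝ)) ((0 : ℝ), t)))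
  rw [← hQ] at hQd
  have cs : HasDerivAt (fun s : ℝ => (s, t)) ((1 : ℝ), (0 : ℝ)) 0 :=
    (hasDerivAt_id _).prodMk (hasDerivAt_const _ _)
  have ct : HasDerivAt (fun τ : ℝ => ((0 : ℝ), τ)) ((0 : ℝ), (1 : ℝ)) t :=
    (hasDerivAt_const _ _).prodMk (hasDerivAt_id _)
  have Qs : HasDerivAt (fun s => Q (s, t))
      (fderiv ℝ y (0, t) (1, 0), fderiv ℝ (fderiv ℝ y) (0, t) (1, 0) (0, 1)) 0 := by
    have h := hQd.comp_hasDerivAt (0 : ℝ) cs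
    simp only [ContinuousLinearMap.prod_apply, add_apply, ContinuousLinearMap.comp_apply,
      zero_apply, map_zero, zero_add, ContinuousLinearMap.flip_apply] at h
    exact h
  have Qt := hQd.comp_hasDerivAt t ct
  have bt : HasDerivAt (fun τ => fderiv ℝ y (0, τ) (1, 0))
      (fderiv ℝ (fderiv ℝ y) (0, t) (0, 1) (1, 0)) t := by
    simpa using (hy2.comp_hasDerivAt t ct).clm_apply (hasDerivAt_const t ((1 : ℝ), (0 : ℝ)))
  -- The `s`-derivative of the identity `h1` at `0` is computed once through `Λ` and once through
  -- `f`.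
  have A := ((hΛ.differentiableAt (by simp)).hasFDerivAt.comp_hasDerivAt (0 : ℝ)
    Qs).congr_of_eventuallyEq (h1.mono fun s hs => hs.symm)
  have Ps : HasDerivAt (fun s => P (s, t)) (deriv (fun s => P (s, t)) 0) 0 :=
    ((hP.differentiable (by simp)).comp (differentiable_id.prodMk (differentiable_const t))
      (0 : ℝ)).hasDerivAt
  have A' := A.unique (((hf.differentiable (by simp)) _).hasFDerivAt.comp_hasDerivAt (0 : ℝ) Ps)
  -- The Euler–Lagrange covector freezes the test vector at time `t`. Letting it move with `δy` adds
  -- `∂_vΛ · ∂_t δy`, which cancels the term `∂_vΛ · δ(∂_t y)` of `A'` by symmetry of `D²y`.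
  have B := deriv_fderiv_apply_sub (Q := fun τ => Q (0, τ)) hΛ Qt bt
  rw [Filter.EventuallyEq.deriv_eq h2] at B
  have S := (hy.isSymmSndFDerivAt (by simpa using two_le_infty)) (1, 0) (0, 1)
  have hsplit : ∀ a b : E, fderiv ℝ Λ (Q (0, t)) (a, b) =
      fderiv ℝ Λ (Q (0, t)) (a, 0) + fderiv ℝ Λ (Q (0, t)) (0, b) := by
    intro a b
    rw [← map_add]; simp
  rw [S, hsplit] at A'
  rw [B, ← A']
  ring

end Abstract

section Tangent

variable {E : Type*} [NormedAddCommGroup E] [NormedSpace ℝ E]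
  {G : Type*} [TopologicalSpace G] [ChartedSpace E G] [IsManifold 𝓘(ℝ, E) ∞ G]

/-- The trivialisation at `p` acts on fibres as the derivative of the chart, so the chain rule gives
the coordinate velocity. -/
theorem extChartAt_tangent_lift (p : TangentBundle 𝓘(ℝ, E) G) {c : ℝ → G} {t : ℝ}
    (hc : MDifferentiableAt 𝓘(ℝ, ℝ) 𝓘(ℝ, E) c t)
    (h : c t ∈ (extChartAt 𝓘(ℝ, E) p.proj).source) :
    extChartAt 𝓘(ℝ, E).tangent p (lift E c t) =
      (extChartAt 𝓘(ℝ, E) p.proj (c t),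
        deriv (fun τ => extChartAt 𝓘(ℝ, E) p.proj (c τ)) t) := by
  have hs : c t ∈ (chartAt E p.proj).source := by simpa using h
  have hφ : MDifferentiableAt 𝓘(ℝ, E) 𝓘(ℝ, E) (extChartAt 𝓘(ℝ, E) p.proj) (c t) :=
    mdifferentiableAt_extChartAt hs
  have e1 : (extChartAt 𝓘(ℝ, E).tangent p (lift E c t)).2 =
      deriv (fun τ => extChartAt 𝓘(ℝ, E) p.proj (c τ)) t := by
    have h1 : (extChartAt 𝓘(ℝ, E).tangent p (lift E c t)).2 =
        (trivializationAt E (TangentSpace 𝓘(ℝ, E)) p.proj (lift E c t)).2 := by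
      rw [FiberBundle.extChartAt]; rfl
    have h2 : (trivializationAt E (TangentSpace 𝓘(ℝ, E)) p.proj (lift E c t)).2 =
        (trivializationAt E (TangentSpace 𝓘(ℝ, E)) p.proj).continuousLinearMapAt ℝ (c t)
          (velocity E c t) := by
      rw [Bundle.Trivialization.continuousLinearMapAt_apply,
        Bundle.Trivialization.linearMapAt_apply, if_pos (by simpa using hs)]
      rfl
    rw [h1, h2, TangentBundle.continuousLinearMapAt_trivializationAt hs, ← fderiv_apply_one_eq_deriv]
    refine (mfderiv_comp_apply t hφ hc (1 : ℝ)).symm.trans ?_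
    rw [mfderiv_eq_fderiv]
    rfl
  have e0 : (extChartAt 𝓘(ℝ, E).tangent p (lift E c t)).1 = extChartAt 𝓘(ℝ, E) p.proj (c t) := by
    rw [FiberBundle.extChartAt]
    rfl
  exact Prod.ext e0 e1

theorem lift_mem_source (p : TangentBundle 𝓘(ℝ, E) G) {c : ℝ → G} {t : ℝ}
    (h : c t ∈ (extChartAt 𝓘(ℝ, E) p.proj).source) :
    lift E c t ∈ (extChartAt 𝓘(ℝ, E).tangent p).source := by
  rw [extChartAt_source, TangentBundle.mem_chart_source_iff]
  have h' : c t ∈ (chartAt E p.proj).source := by simpa using h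
  exact h'

end Tangent
end LAEP

/-! ### Variations of curves and the Euler–Lagrange covector in the mean variables. -/

namespace LAEP

section ChartCurves

variable {E : Type*} [NormedAddCommGroup E] [NormedSpace ℝ E]
  {G : Type*} [TopologicalSpace G] [ChartedSpace E G] [IsManifold 𝓘(ℝ, E) ∞ G]

/-- Variations of a constant curve with prescribed derivative `θ(t) w`. -/
theorem exists_variation (p : G) (w : E) {θ : ℝ → ℝ} (hθ : ContDiff ℝ ∞ θ) {C : ℝ}
    (hC : ∀ t, |θ t| ≤ C) :
    ∃ ψ : ℝ → ℝ → G, ContMDiff 𝓘(ℝ, ℝ × ℝ) 𝓘(ℝ, E) ∞ (fun q : ℝ × ℝ => ψ q.1 q.2) ∧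
      (∀ t, ψ 0 t = p) ∧ (∀ s t, θ t = 0 → ψ s t = p) ∧
      ∀ t, deriv (fun s => extChartAt 𝓘(ℝ, E) p (ψ s t)) 0 = θ t • w := by
  set φ := extChartAt 𝓘(ℝ, E) p with hφ
  have hC0 : 0 ≤ C := (abs_nonneg _).trans (hC 0)
  obtain ⟨r, hr, hball⟩ := Metric.mem_nhds_iff.1 (extChartAt_target_mem_nhds (I := 𝓘(ℝ, E)) p)
  -- The function `δ sin(s/δ)` has slope `1` at `0` but is bounded by `δ`; this `δ` keeps the point
  -- in the ball of radius `r` inside the chart for all `s` and `t`. The `1` keeps the denominator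
  -- positive and the inequality strict.
  set δ := r / (C * ‖w‖ + 1) with hδ
  have hden : 0 < C * ‖w‖ + 1 := by positivity
  have hδ0 : 0 < δ := div_pos hr hden
  let x : ℝ × ℝ → E := fun q => φ p + (δ * Real.sin (q.1 / δ) * θ q.2) • w
  have hx : ContDiff ℝ ∞ x :=
    contDiff_const.add ((((contDiff_const.mul (Real.contDiff_sin.comp
      (contDiff_fst.div_const δ))).mul (hθ.comp contDiff_snd))).smul contDiff_const)
  have hxt : ∀ q, x q ∈ φ.target := by
    intro q
    apply hball
    rw [mem_ball_iff_norm, add_sub_cancel_left, norm_smul, Real.norm_eq_abs, abs_mul, abs_mul,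
      abs_of_pos hδ0]
    have h1 : δ * |Real.sin (q.1 / δ)| * |θ q.2| * ‖w‖ ≤ δ * 1 * C * ‖w‖ := by
      gcongr
      · exact Real.abs_sin_le_one _
      · exact hC _
    have h2 : δ * 1 * C * ‖w‖ < δ * (C * ‖w‖ + 1) := by nlinarith
    have h3 : δ * (C * ‖w‖ + 1) = r := div_mul_cancel₀ r hden.ne'
    linarith
  refine ⟨fun s t => φ.symm (x (s, t)), ?_, ?_, ?_, ?_⟩
  · exact (contMDiffOn_extChartAt_symm p).comp_contMDiff hx.contMDiff hxt
  · intro t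
    simp [x, hφ]
  · intro s t h
    simp [x, h, hφ]
  · intro t
    have h1 : (fun s => φ (φ.symm (x (s, t)))) = fun s => x (s, t) :=
      funext fun s => φ.right_inv (hxt _)
    have h2 : HasDerivAt (fun s : ℝ => Real.sin (s / δ)) (1 / δ) 0 := by
      have := ((hasDerivAt_id (0 : ℝ)).div_const δ).sin
      simpa using this
    have h3 := (((h2.const_mul δ).mul_const (θ t)).smul_const w).const_add (φ p)
    have h4 : δ * (1 / δ) * θ t = θ t := by field_simp
    rw [h4] at h3
    rw [h1]
    exact h3.deriv

end ChartCurves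

section EulerLagrange

variable {E : Type*} [NormedAddCommGroup E] [NormedSpace ℝ E]
  {G : Type*} [TopologicalSpace G] [ChartedSpace E G] [Group G] [LieGroup 𝓘(ℝ, E) ∞ G]
  {V : Type*} [NormedAddCommGroup V] [NormedSpace ℝ V]

theorem contDiff_logDeriv_fst {γ : ℝ → ℝ → G}
    (hγ : ContMDiff 𝓘(ℝ, ℝ × ℝ) 𝓘(ℝ, E) ∞ (fun p : ℝ × ℝ => γ p.1 p.2)) :
    ContDiff ℝ ∞ (fun p : ℝ × ℝ => logDeriv E (γ p.1) p.2) := by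
  refine contDiff_logDeriv (F := ℝ × ℝ) (c := fun p => γ p.1) (s := Prod.snd) ?_ contDiff_snd
  exact hγ.comp ((contDiff_fst.comp contDiff_fst).prodMk contDiff_snd).contMDiff

theorem contDiff_logDeriv_snd {γ : ℝ → ℝ → G}
    (hγ : ContMDiff 𝓘(ℝ, ℝ × ℝ) 𝓘(ℝ, E) ∞ (fun p : ℝ × ℝ => γ p.1 p.2)) :
    ContDiff ℝ ∞ (fun p : ℝ × ℝ => logDeriv E (fun r => γ r p.2) p.1) := by
  refine contDiff_logDeriv (F := ℝ × ℝ) (c := fun p r => γ r p.2) (s := Prod.fst) ?_ contDiff_fst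
  exact hγ.comp (contDiff_snd.prodMk (contDiff_snd.comp contDiff_fst)).contMDiff

/-- The mean variables `(t, ũ, ã)` along a family of curves. -/
noncomputable def meanVars (ρ : RightRep E G V) (a₀ : StrongDual ℝ V) (γ : ℝ → ℝ → G)
    (p : ℝ × ℝ) : ℝ × E × StrongDual ℝ V :=
  (p.2, logDeriv E (γ p.1) p.2, a₀.comp (ρ.act (γ p.1 p.2)))

theorem contDiff_meanVars (ρ : RightRep E G V) (a₀ : StrongDual ℝ V) {γ : ℝ → ℝ → G}
    (hγ : ContMDiff 𝓘(ℝ, ℝ × ℝ) 𝓘(ℝ, E) ∞ (fun p : ℝ × ℝ => γ p.1 p.2)) :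
    ContDiff ℝ ∞ (meanVars ρ a₀ γ) :=
  contDiff_snd.prodMk ((contDiff_logDeriv_fst hγ).prodMk
    (contDiff_const.clm_comp (ρ.contDiff_act hγ)))

theorem contMDiff_curve_fst {γ : ℝ → ℝ → G}
    (hγ : ContMDiff 𝓘(ℝ, ℝ × ℝ) 𝓘(ℝ, E) ∞ (fun p : ℝ × ℝ => γ p.1 p.2)) (t : ℝ) :
    ContMDiff 𝓘(ℝ, ℝ) 𝓘(ℝ, E) ∞ (fun s => γ s t) :=
  hγ.comp (contDiff_id.prodMk contDiff_const).contMDiff (f := fun τ => (τ, t))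

theorem contMDiff_curve_snd {γ : ℝ → ℝ → G}
    (hγ : ContMDiff 𝓘(ℝ, ℝ × ℝ) 𝓘(ℝ, E) ∞ (fun p : ℝ × ℝ => γ p.1 p.2)) (s : ℝ) :
    ContMDiff 𝓘(ℝ, ℝ) 𝓘(ℝ, E) ∞ (γ s) :=
  hγ.comp (contDiff_const.prodMk contDiff_id).contMDiff (f := fun τ => (s, τ))

/-- The constrained variations `δũ = ∂_t η + ad_ũ η`, `δã = -ã η`. -/
theorem hasDerivAt_meanVars (ρ : RightRep E G V) (a₀ : StrongDual ℝ V) {γ : ℝ → ℝ → G}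
    (hγ : ContMDiff 𝓘(ℝ, ℝ × ℝ) 𝓘(ℝ, E) ∞ (fun p : ℝ × ℝ => γ p.1 p.2)) (s t : ℝ) :
    HasDerivAt (fun r => meanVars ρ a₀ γ (r, t))
      (0, deriv (fun τ => logDeriv E (fun r => γ r τ) s) t
          + adOp G (logDeriv E (γ s) t) (logDeriv E (fun r => γ r t) s),
        -((a₀.comp (ρ.act (γ s t))).comp (ρ.infOp (logDeriv E (fun r => γ r t) s)))) s := by
  have h1 : HasDerivAt (fun r => logDeriv E (γ r) t) _ s :=
    (((contDiff_logDeriv_fst hγ).differentiable (by simp)).comp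
      (differentiable_id.prodMk (differentiable_const t)) s).hasDerivAt
  rw [← maurer_cartan hγ]
  exact (hasDerivAt_const s t).prodMk (h1.prodMk
    (ρ.hasDerivAt_comp_act a₀ (contMDiff_curve_fst hγ t).contMDiffAt))

theorem contDiffAt_lagrangian_chart {L : TangentBundle 𝓘(ℝ, E) G → StrongDual ℝ V → ℝ}
    (hL : SmoothLagrangian L) (a₀ : StrongDual ℝ V) (p : TangentBundle 𝓘(ℝ, E) G) :
    ContDiffAt ℝ ∞ (fun q : E × E => L ((extChartAt 𝓘(ℝ, E).tangent p).symm q) a₀)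
      (extChartAt 𝓘(ℝ, E).tangent p p) := by
  have h1 : ContMDiff 𝓘(ℝ, E).tangent 𝓘(ℝ, ℝ) ∞
      (fun q : TangentBundle 𝓘(ℝ, E) G => L q a₀) :=
    hL.comp (contMDiff_id.prodMk contMDiff_const)
  have h2 : ContMDiffAt 𝓘(ℝ, E × E) 𝓘(ℝ, E).tangent ∞ (extChartAt 𝓘(ℝ, E).tangent p).symm
      (extChartAt 𝓘(ℝ, E).tangent p p) :=
    (contMDiffOn_extChartAt_symm p).contMDiffAt (extChartAt_target_mem_nhds p)
  exact (h1.contMDiffAt.comp _ h2).contDiffAt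

/-- The Euler-Lagrange covector in the mean variables. -/
theorem eulerLagrange_glm {ρ : RightRep E G V}
    {L : TangentBundle 𝓘(ℝ, E) G → StrongDual ℝ V → ℝ} (hL : SmoothLagrangian L)
    (hinv : RightInvariant ρ L) (a₀ : StrongDual ℝ V) {Ξ : ℝ → G}
    (hΞ : ContMDiff 𝓘(ℝ, ℝ) 𝓘(ℝ, E) ∞ Ξ) {γ : ℝ → ℝ → G}
    (hγ : ContMDiff 𝓘(ℝ, ℝ × ℝ) 𝓘(ℝ, E) ∞ (fun p : ℝ × ℝ => γ p.1 p.2)) {η : E}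
    (hη : ∀ τ, logDeriv E (fun s => γ s τ) 0 = η) (t : ℝ) :
    eulerLagrange (fun q => L q a₀) (glm Ξ (γ 0)) t
      (leftTranslate (Ξ t) (velocity E (fun s => γ s t) 0)) =
    fderiv ℝ (fluctuatingLagrangian ρ L Ξ) (meanVars ρ a₀ γ (0, t))
        (0, adOp G (logDeriv E (γ 0) t) η, -((a₀.comp (ρ.act (γ 0 t))).comp (ρ.infOp η)))
      - deriv (fun τ => fderiv ℝ (fluctuatingLagrangian ρ L Ξ) (meanVars ρ a₀ γ (0, τ))
          (0, η, 0)) t := by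
  set p : TangentBundle 𝓘(ℝ, E) G := lift E (glm Ξ (γ 0)) t with hp
  set Λ : E × E → ℝ := fun q => L ((extChartAt 𝓘(ℝ, E).tangent p).symm q) a₀ with hΛdef
  set f := fluctuatingLagrangian ρ L Ξ with hfdef
  have hf : ContDiff ℝ ∞ f := contDiff_fluctuatingLagrangian ρ hL hΞ
  have hpp : p.proj = Ξ t * γ 0 t := rfl
  let y : ℝ × ℝ → E := fun q => extChartAt 𝓘(ℝ, E) p.proj (Ξ q.2 * γ q.1 q.2)
  let Q : ℝ × ℝ → E × E := fun q => (y q, fderiv ℝ y q (0, 1))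
  have hΞγ : ContMDiff 𝓘(ℝ, ℝ × ℝ) 𝓘(ℝ, E) ∞ (fun q : ℝ × ℝ => Ξ q.2 * γ q.1 q.2) :=
    (hΞ.comp contDiff_snd.contMDiff).mul hγ
  have hy : ContDiffAt ℝ ∞ y (0, t) := contDiffAt_chart_comp hΞγ.contMDiffAt rfl
  have hsrc : ∀ᶠ q in nhds ((0 : ℝ), t),
      Ξ q.2 * γ q.1 q.2 ∈ (extChartAt 𝓘(ℝ, E) p.proj).source :=
    hΞγ.continuous.continuousAt.preimage_mem_nhds (x := ((0 : ℝ), t))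
      (extChartAt_source_mem_nhds' (I := 𝓘(ℝ, E)) (mem_extChartAt_source (I := 𝓘(ℝ, E)) p.proj))
  have hyd : ∀ᶠ q in nhds ((0 : ℝ), t), DifferentiableAt ℝ y q := by
    filter_upwards [(hy.of_le (m := 1) (by simp)).eventually (by simp)] with q hq
    exact hq.differentiableAt (by simp)
  -- the value of the Lagrangian along a curve, in coordinates and in the mean variables
  have key : ∀ (c : ℝ → G), ContMDiff 𝓘(ℝ, ℝ) 𝓘(ℝ, E) ∞ c → ∀ τ,
      Ξ τ * c τ ∈ (extChartAt 𝓘(ℝ, E) p.proj).source →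
      Λ (extChartAt 𝓘(ℝ, E) p.proj (Ξ τ * c τ),
        deriv (fun r => extChartAt 𝓘(ℝ, E) p.proj (Ξ r * c r)) τ) =
      f (τ, logDeriv E c τ, a₀.comp (ρ.act (c τ))) := by
    intro c hc τ hs
    rw [hfdef, ← lagrangian_lift_glm hinv a₀ hΞ hc]
    have h1 := extChartAt_tangent_lift p (c := glm Ξ c)
      ((hΞ.mul hc).mdifferentiable (by simp) τ) hs
    have h2 := (extChartAt 𝓘(ℝ, E).tangent p).left_inv (lift_mem_source p (c := glm Ξ c) hs)
    rw [h1] at h2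
    exact congrArg (fun q => L q a₀) h2
  have hQt : Q (0, t) = extChartAt 𝓘(ℝ, E).tangent p p := by
    refine Eq.trans ?_ (extChartAt_tangent_lift p (c := glm Ξ (γ 0))
      ((hΞ.mul (contMDiff_curve_snd hγ 0)).mdifferentiable (by simp) t)
      (mem_extChartAt_source p.proj)).symm
    exact Prod.ext rfl (deriv_snd_eq_fderiv (hy.differentiableAt (by simp))).symm
  have hΛ : ContDiffAt ℝ ∞ Λ (Q (0, t)) := hQt ▸ contDiffAt_lagrangian_chart hL a₀ p
  have hQc : ContinuousAt Q (0, t) :=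
    (hy.continuousAt).prodMk ((hy.fderiv_right (m := ∞) (by simp)).continuousAt.clm_apply
      continuousAt_const)
  have hΛd : ∀ᶠ q in nhds ((0 : ℝ), t), DifferentiableAt ℝ Λ (Q q) := by
    have := (hΛ.of_le (m := 1) (by simp)).eventually (by simp)
    filter_upwards [hQc.eventually this] with q hq using hq.differentiableAt (by simp)
  have cs : Filter.Tendsto (fun s : ℝ => (s, t)) (nhds 0) (nhds (0, t)) :=
    (Continuous.prodMk_left t).tendsto 0
  have ct : Filter.Tendsto (fun τ : ℝ => ((0 : ℝ), τ)) (nhds t) (nhds (0, t)) :=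
    (Continuous.prodMk_right (0 : ℝ)).tendsto t
  have h1 : ∀ᶠ s in nhds (0 : ℝ), Λ (Q (s, t)) = f (meanVars ρ a₀ γ (s, t)) := by
    filter_upwards [cs.eventually hsrc, cs.eventually hyd] with s hs hd
    have h := key (γ s) (contMDiff_curve_snd hγ s) t hs
    have h' : fderiv ℝ y (s, t) (0, 1) =
        deriv (fun r => extChartAt 𝓘(ℝ, E) p.proj (Ξ r * γ s r)) t := (deriv_snd_eq_fderiv hd).symm
    simp only [Q, h']
    exact h
  have h2 : ∀ᶠ τ in nhds t, fderiv ℝ Λ (Q (0, τ)) (0, fderiv ℝ y (0, τ) (1, 0)) =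
      fderiv ℝ f (meanVars ρ a₀ γ (0, τ)) (0, η, 0) := by
    filter_upwards [ct.eventually hsrc, ct.eventually hyd, ct.eventually hΛd] with τ hs hd hl
    have e1 := hasDerivAt_line hl ((0 : E), fderiv ℝ y (0, τ) (1, 0))
    have e2 := hasDerivAt_line ((hf.differentiable (by simp)) (meanVars ρ a₀ γ (0, τ)))
      ((0 : ℝ), η, (0 : StrongDual ℝ V))
    refine e1.unique (e2.congr_of_eventuallyEq (Filter.Eventually.of_forall fun r => ?_))
    -- This slanted curve has the same position as `γ 0` at time `τ`, but its coordinate velocity is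
    -- increased by `r δy` and its logarithmic derivative by `r η`: one fibre derivative seen in
    -- both sets of variables.
    have hc : ContMDiff 𝓘(ℝ, ℝ) 𝓘(ℝ, E) ∞ (fun x => γ (0 + r * (x - τ)) x) := by
      refine hγ.comp (f := fun x : ℝ => (0 + r * (x - τ), x)) (ContDiff.contMDiff ?_)
      fun_prop
    have h := key _ hc τ (by simpa using hs)
    have h3 := deriv_comp_affine hd r
    rw [deriv_snd_eq_fderiv hd, deriv_fst_eq_fderiv hd] at h3
    have h4 : deriv (fun x => extChartAt 𝓘(ℝ, E) p.proj (Ξ x * γ (0 + r * (x - τ)) x)) τ =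
      fderiv ℝ y (0, τ) (0, 1) + r • fderiv ℝ y (0, τ) (1, 0) := h3
    rw [h4, logDeriv_affine hγ, hη] at h
    simp only [sub_self, mul_zero, add_zero] at h
    have h5 : Q (0, τ) + r • ((0 : E), fderiv ℝ y (0, τ) (1, 0)) =
      (y (0, τ), fderiv ℝ y (0, τ) (0, 1) + r • fderiv ℝ y (0, τ) (1, 0)) := by
      simp [Q]
    have h6 : meanVars ρ a₀ γ (0, τ) + r • ((0 : ℝ), η, (0 : StrongDual ℝ V)) =
      (τ, logDeriv E (γ 0) τ + r • η, a₀.comp (ρ.act (γ 0 τ))) := by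
      simp [meanVars]
    beta_reduce
    rw [h5, h6]
    exact h
  have main := eulerLagrange_coordinates hy (Q := Q) rfl hΛ hf (contDiff_meanVars ρ a₀ hγ) h1 h2
  -- Since `η` is the same at all times, the term `∂_t η` drops out of the constrained variation.
  rw [(hasDerivAt_meanVars ρ a₀ hγ 0 t).deriv] at main
  simp only [hη, deriv_const, zero_add] at main
  rw [← main]
  have hw : (show E from leftTranslate (Ξ t) (velocity E (fun s => γ s t) 0)) =
      fderiv ℝ y (0, t) (1, 0) := by
    have m1 := mdifferentiableAt_mul_left E (Ξ t) (γ 0 t)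
    have m2 : MDifferentiableAt 𝓘(ℝ, ℝ) 𝓘(ℝ, E) (fun s => γ s t) 0 :=
      (contMDiff_curve_fst hγ t).mdifferentiable (by simp) 0
    have e1 := (mfderiv_comp_apply (0 : ℝ) m1 m2 (1 : ℝ)).symm
    have e2 := mfderiv_eq_fderiv_chart (p := p.proj) (m1.comp (0 : ℝ) m2) hpp.symm (1 : ℝ)
    refine (e1.trans e2).trans ?_
    rw [← deriv_fst_eq_fderiv hyd.self_of_nhds, ← fderiv_apply_one_eq_deriv]
    rfl
  have hQe : (fun τ => extChartAt 𝓘(ℝ, E).tangent p (lift E (glm Ξ (γ 0)) τ)) =ᶠ[nhds t]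
      fun τ => Q (0, τ) := by
    filter_upwards [ct.eventually hsrc, ct.eventually hyd] with τ hs hd
    rw [extChartAt_tangent_lift p (c := glm Ξ (γ 0))
      ((hΞ.mul (contMDiff_curve_snd hγ 0)).mdifferentiable (by simp) τ) hs]
    exact Prod.ext rfl (deriv_snd_eq_fderiv hd)
  have hD := Filter.EventuallyEq.deriv_eq (hQe.fun_comp
    (fun q => fderiv ℝ Λ q (0, fderiv ℝ y (0, t) (1, 0))))
  have hE : ∀ w : TangentSpace 𝓘(ℝ, E) (glm Ξ (γ 0) t),
      eulerLagrange (fun q => L q a₀) (glm Ξ (γ 0)) t w =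
      fderiv ℝ Λ (extChartAt 𝓘(ℝ, E).tangent p p) ((show E from w), 0) -
      deriv (fun τ => fderiv ℝ Λ (extChartAt 𝓘(ℝ, E).tangent p (lift E (glm Ξ (γ 0)) τ))
        (0, (show E from w))) t := fun w => rfl
  refine (hE _).trans ?_
  rw [hw, ← hQt]
  exact congrArg _ hD

end EulerLagrange
end LAEP

/-! ### The residual, integration by parts and the fundamental lemma. -/

namespace LAEP

variable {E : Type*} [NormedAddCommGroup E] [NormedSpace ℝ E]
  {G : Type*} [TopologicalSpace G] [ChartedSpace E G] [Group G] [LieGroup 𝓘(ℝ, E) ∞ G]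
  {V : Type*} [NormedAddCommGroup V] [NormedSpace ℝ V]
  {Ω : Type*} [MeasurableSpace Ω] {μ : Measure Ω}

theorem DominatedFamily.sub {Y : Type*} [TopologicalSpace Y] {h h' : Ω → Y → ℝ}
    (hh : DominatedFamily μ h) (hh' : DominatedFamily μ h') :
    DominatedFamily μ (fun σ y => h σ y - h' σ y) where
  meas y := (hh.meas y).sub (hh'.meas y)
  cont σ := (hh.cont σ).sub (hh'.cont σ)
  bound C hC := by
    obtain ⟨B, hB, hb⟩ := hh.bound C hC
    obtain ⟨B', hB', hb'⟩ := hh'.bound C hC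
    refine ⟨fun σ => B σ + B' σ, hB.add hB', ?_⟩
    filter_upwards [hb, hb'] with σ h1 h2 y hy
    exact (norm_sub_le _ _).trans (add_le_add (h1 y hy) (h2 y hy))

/-- The variables `(t, ũ, ã)` along the mean curve. -/
noncomputable def curveVars (ρ : RightRep E G V) (a₀ : StrongDual ℝ V) (g : ℝ → G) (t : ℝ) :
    ℝ × E × StrongDual ℝ V :=
  (t, logDeriv E g t, a₀.comp (ρ.act (g t)))

/-- The part of the constrained variation of `(t, ũ, ã)` that does not involve `∂_t η`. -/
noncomputable def transportVars (ρ : RightRep E G V) (a₀ : StrongDual ℝ V) (g : ℝ → G) (t : ℝ)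
    (η : E) : ℝ × E × StrongDual ℝ V :=
  (0, adOp G (logDeriv E g t) η, -((a₀.comp (ρ.act (g t))).comp (ρ.infOp η)))

/-- The Euler-Poincaré residual, paired with `η`. -/
noncomputable def residual (ρ : RightRep E G V)
    (L : TangentBundle 𝓘(ℝ, E) G → StrongDual ℝ V → ℝ) (a₀ : StrongDual ℝ V) (Ξ g : ℝ → G) (t : ℝ)
    (η : E) : ℝ :=
  fderiv ℝ (fluctuatingLagrangian ρ L Ξ) (curveVars ρ a₀ g t) (transportVars ρ a₀ g t η)
    - fderiv ℝ (fderiv ℝ (fluctuatingLagrangian ρ L Ξ)) (curveVars ρ a₀ g t)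
      (deriv (curveVars ρ a₀ g) t) (0, η, 0)

theorem contDiff_curveVars (ρ : RightRep E G V) (a₀ : StrongDual ℝ V) {g : ℝ → G}
    (hg : ContMDiff 𝓘(ℝ, ℝ) 𝓘(ℝ, E) ∞ g) : ContDiff ℝ ∞ (curveVars ρ a₀ g) :=
  (contDiff_meanVars ρ a₀ (γ := fun _ => g) (hg.comp contDiff_snd.contMDiff)).comp
    (f := fun t : ℝ => ((0 : ℝ), t)) (contDiff_const.prodMk contDiff_id)

theorem contDiff_adOp {u η : ℝ → E} (hu : ContDiff ℝ ∞ u) (hη : ContDiff ℝ ∞ η) :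
    ContDiff ℝ ∞ (fun t => adOp G (u t) (η t)) := by
  simp_rw [adOp_eq]
  exact ((contDiff_const.clm_apply (hη.prodMk contDiff_const)).clm_apply
    (contDiff_const.prodMk hu)).sub ((contDiff_const.clm_apply (hu.prodMk contDiff_const)).clm_apply
    (contDiff_const.prodMk hη))

theorem contDiff_curve_logDeriv {g : ℝ → G} (hg : ContMDiff 𝓘(ℝ, ℝ) 𝓘(ℝ, E) ∞ g) :
    ContDiff ℝ ∞ (fun t => logDeriv E g t) :=
  (contDiff_logDeriv_fst (γ := fun _ => g) (hg.comp contDiff_snd.contMDiff)).comp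
    (f := fun t : ℝ => ((0 : ℝ), t)) (contDiff_const.prodMk contDiff_id)

theorem contDiff_transportVars (ρ : RightRep E G V) (a₀ : StrongDual ℝ V) {g : ℝ → G}
    (hg : ContMDiff 𝓘(ℝ, ℝ) 𝓘(ℝ, E) ∞ g) {η : ℝ → E} (hη : ContDiff ℝ ∞ η) :
    ContDiff ℝ ∞ (fun t => transportVars ρ a₀ g t (η t)) :=
  contDiff_const.prodMk ((contDiff_adOp (contDiff_curve_logDeriv hg) hη).prodMk
    ((contDiff_const.clm_comp (ρ.contDiff_act hg)).clm_comp (ρ.infOp.contDiff.comp hη)).neg)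

theorem transportVars_smul (ρ : RightRep E G V) (a₀ : StrongDual ℝ V) (g : ℝ → G) (t c : ℝ)
    (η : E) : transportVars ρ a₀ g t (c • η) = c • transportVars ρ a₀ g t η := by
  have h1 : ∀ x : E, ((c • x, 0) : E × E) = c • (x, 0) := fun x => by simp
  have h2 : ∀ x : E, ((0, c • x) : E × E) = c • (0, x) := fun x => by simp
  have h3 : adOp G (logDeriv E g t) (c • η) = c • adOp G (logDeriv E g t) η := by
    rw [adOp_eq, adOp_eq, h1, h2, map_smul, map_smul, smul_sub]
    rfl
  simp only [transportVars, h3, map_smul, ContinuousLinearMap.comp_smul, Prod.smul_mk, smul_neg,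
    smul_zero]

/-- Homogeneity lets a scalar test function `θ(t)` leave the residual, which is all that the
fundamental lemma requires. -/
theorem residual_smul (ρ : RightRep E G V)
    (L : TangentBundle 𝓘(ℝ, E) G → StrongDual ℝ V → ℝ) (a₀ : StrongDual ℝ V) (Ξ g : ℝ → G)
    (t c : ℝ) (η : E) : residual ρ L a₀ Ξ g t (c • η) = c * residual ρ L a₀ Ξ g t η := by
  have h : ((0 : ℝ), c • η, (0 : StrongDual ℝ V)) = c • ((0 : ℝ), η, (0 : StrongDual ℝ V)) := by
    simp
  rw [residual, residual, transportVars_smul, h, map_smul, map_smul, smul_eq_mul, smul_eq_mul,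
    mul_sub]

section Mean

variable {ρ : RightRep E G V} {L : TangentBundle 𝓘(ℝ, E) G → StrongDual ℝ V → ℝ}
  {Ξ : Ω → ℝ → G} {g : ℝ → G}

theorem family_residual (hL : SmoothLagrangian L) (a₀ : StrongDual ℝ V)
    (hΞ : ∀ σ, ContMDiff 𝓘(ℝ, ℝ) 𝓘(ℝ, E) ∞ (Ξ σ)) (hg : ContMDiff 𝓘(ℝ, ℝ) 𝓘(ℝ, E) ∞ g)
    (hdom : DominatedC2 μ (fun σ => fluctuatingLagrangian ρ L (Ξ σ)))
    {η : ℝ → E} (hη : ContDiff ℝ ∞ η) :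
    DominatedFamily μ (fun σ t => residual ρ L a₀ (Ξ σ) g t (η t)) := by
  have hf := fun σ => contDiff_fluctuatingLagrangian ρ hL (hΞ σ)
  have hp := contDiff_curveVars ρ a₀ hg
  exact (hdom.family_fderiv hf hp.continuous (contDiff_transportVars ρ a₀ hg hη).continuous).sub
    (hdom.family_fderiv_fderiv hf hp.continuous (hp.continuous_deriv (by simp))
      (continuous_const.prodMk (hη.continuous.prodMk continuous_const)))

/-- Integration by parts in the mean action. -/
theorem integral_residual (hL : SmoothLagrangian L) (a₀ : StrongDual ℝ V)
    (hΞ : ∀ σ, ContMDiff 𝓘(ℝ, ℝ) 𝓘(ℝ, E) ∞ (Ξ σ)) (hg : ContMDiff 𝓘(ℝ, ℝ) 𝓘(ℝ, E) ∞ g)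
    (hdom : DominatedC2 μ (fun σ => fluctuatingLagrangian ρ L (Ξ σ)))
    {η : ℝ → E} (hη : ContDiff ℝ ∞ η) {t₁ t₂ : ℝ} (h₁ : η t₁ = 0) (h₂ : η t₂ = 0) :
    ∫ t in t₁..t₂, ∫ σ, fderiv ℝ (fluctuatingLagrangian ρ L (Ξ σ)) (curveVars ρ a₀ g t)
        ((0, deriv η t, 0) + transportVars ρ a₀ g t (η t)) ∂μ =
      ∫ t in t₁..t₂, ∫ σ, residual ρ L a₀ (Ξ σ) g t (η t) ∂μ := by
  have hf := fun σ => contDiff_fluctuatingLagrangian ρ hL (hΞ σ)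
  have hp := contDiff_curveVars ρ a₀ hg
  have hv : ContDiff ℝ ∞ (fun t => ((0 : ℝ), η t, (0 : StrongDual ℝ V))) :=
    contDiff_const.prodMk (hη.prodMk contDiff_const)
  have hv' : ∀ t, deriv (fun t => ((0 : ℝ), η t, (0 : StrongDual ℝ V))) t = (0, deriv η t, 0) :=
    fun t => ((hasDerivAt_const t (0 : ℝ)).prodMk (((hη.differentiable (by simp)) t).hasDerivAt.prodMk
      (hasDerivAt_const t (0 : StrongDual ℝ V)))).deriv
  have hd := hdom.hasDerivAt_mean_fderiv hf hp hv
  simp only [hv'] at hd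
  have hη' : Continuous (fun t => ((0 : ℝ), deriv η t, (0 : StrongDual ℝ V))) :=
    continuous_const.prodMk ((hη.continuous_deriv (by simp)).prodMk continuous_const)
  have F1 := (hdom.family_fderiv_fderiv hf hp.continuous (hp.continuous_deriv (by simp))
    hv.continuous).add (hdom.family_fderiv hf hp.continuous hη')
  have F2 := family_residual hL a₀ hΞ hg hdom hη
  -- The total derivative of the mean momentum paired with `η(t)` integrates to zero, because `η`
  -- vanishes at both ends.
  have hI := intervalIntegral.integral_eq_sub_of_hasDerivAt (a := t₁) (b := t₂) (fun t _ => hd t)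
    (F1.continuous_mean.intervalIntegrable _ _)
  have h0 : ((0 : ℝ), (0 : E), (0 : StrongDual ℝ V)) = 0 := rfl
  simp only [h₁, h₂, h0, map_zero, integral_zero, sub_zero] at hI
  have hsum : ∀ t, ∫ σ, fderiv ℝ (fluctuatingLagrangian ρ L (Ξ σ)) (curveVars ρ a₀ g t)
        ((0, deriv η t, 0) + transportVars ρ a₀ g t (η t)) ∂μ =
      (∫ σ, (fderiv ℝ (fderiv ℝ (fluctuatingLagrangian ρ L (Ξ σ))) (curveVars ρ a₀ g t)
        (deriv (curveVars ρ a₀ g) t) (0, η t, 0)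
        + fderiv ℝ (fluctuatingLagrangian ρ L (Ξ σ)) (curveVars ρ a₀ g t) (0, deriv η t, 0)) ∂μ)
      + ∫ σ, residual ρ L a₀ (Ξ σ) g t (η t) ∂μ := by
    intro t
    rw [← integral_add (F1.integrable t) (F2.integrable t)]
    refine integral_congr_ae (Filter.Eventually.of_forall fun σ => ?_)
    simp only [residual, map_add]
    ring
  simp_rw [hsum]
  rw [intervalIntegral.integral_add (F1.continuous_mean.intervalIntegrable _ _)
    (F2.continuous_mean.intervalIntegrable _ _), hI, zero_add]

/-- The fundamental lemma of the calculus of variations for the mean residual. -/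
theorem mean_residual_eq_zero (hL : SmoothLagrangian L) (a₀ : StrongDual ℝ V)
    (hΞ : ∀ σ, ContMDiff 𝓘(ℝ, ℝ) 𝓘(ℝ, E) ∞ (Ξ σ)) (hg : ContMDiff 𝓘(ℝ, ℝ) 𝓘(ℝ, E) ∞ g)
    (hdom : DominatedC2 μ (fun σ => fluctuatingLagrangian ρ L (Ξ σ))) {t₁ t₂ : ℝ} (ht : t₁ < t₂)
    (η : E)
    (h : ∀ θ : ℝ → ℝ, ContDiff ℝ ∞ θ → HasCompactSupport θ → θ t₁ = 0 → θ t₂ = 0 →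
      ∫ t in t₁..t₂, ∫ σ, residual ρ L a₀ (Ξ σ) g t (θ t • η) ∂μ = 0) :
    ∀ t ∈ Set.Icc t₁ t₂, ∫ σ, residual ρ L a₀ (Ξ σ) g t η ∂μ = 0 := by
  have hc : Continuous (fun t => ∫ σ, residual ρ L a₀ (Ξ σ) g t η ∂μ) :=
    (family_residual hL a₀ hΞ hg hdom (contDiff_const (c := η))).continuous_mean
  have hae := (isOpen_Ioo (a := t₁) (b := t₂)).ae_eq_zero_of_integral_contDiff_smul_eq_zero
    (μ := volume) (f := fun t => ∫ σ, residual ρ L a₀ (Ξ σ) g t η ∂μ)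
    (hc.locallyIntegrable.locallyIntegrableOn _) (fun θ hθ hθc hθs => by
      have hz : ∀ t, t ∉ Set.Ioo t₁ t₂ → θ t = 0 := fun t ht' =>
        image_eq_zero_of_notMem_tsupport fun h' => ht' (hθs h')
      have h1 := h θ hθ hθc (hz _ (by simp)) (hz _ (by simp))
      simp_rw [residual_smul, integral_const_mul] at h1
      rw [intervalIntegral.integral_of_le ht.le, setIntegral_eq_integral_of_forall_compl_eq_zero] at h1
      · simpa using h1
      · intro t ht'
        rw [hz t fun h' => ht' (Set.Ioo_subset_Ioc_self h'), zero_mul])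
  -- Continuity of the mean residual upgrades almost everywhere to everywhere on the open interval,
  -- and then to the endpoints by closure.
  have hEq : Set.EqOn (fun t => ∫ σ, residual ρ L a₀ (Ξ σ) g t η ∂μ) (fun _ => 0)
      (Set.Ioo t₁ t₂) := by
    refine Measure.eqOn_open_of_ae_eq (μ := volume) ?_ isOpen_Ioo hc.continuousOn continuousOn_const
    exact (ae_restrict_iff' measurableSet_Ioo).2 hae
  have hcl := hEq.closure hc continuous_const
  rw [closure_Ioo ht.ne] at hcl
  exact hcl

end Mean

end LAEP

/-! ### The four conditions as vanishing of the mean residual. -/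

namespace LAEP

variable {E : Type*} [NormedAddCommGroup E] [NormedSpace ℝ E]
  {G : Type*} [TopologicalSpace G] [ChartedSpace E G] [Group G] [LieGroup 𝓘(ℝ, E) ∞ G]
  {V : Type*} [NormedAddCommGroup V] [NormedSpace ℝ V]
  {Ω : Type*} [MeasurableSpace Ω] {μ : Measure Ω}
  {ρ : RightRep E G V} {L : TangentBundle 𝓘(ℝ, E) G → StrongDual ℝ V → ℝ}
  {Ξ : Ω → ℝ → G} {g : ℝ → G}

theorem eulerLagrange_eq_residual (hL : SmoothLagrangian L) (hinv : RightInvariant ρ L)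
    (a₀ : StrongDual ℝ V) {Ξ : ℝ → G} (hΞ : ContMDiff 𝓘(ℝ, ℝ) 𝓘(ℝ, E) ∞ Ξ) {γ : ℝ → ℝ → G}
    (hγ : ContMDiff 𝓘(ℝ, ℝ × ℝ) 𝓘(ℝ, E) ∞ (fun p : ℝ × ℝ => γ p.1 p.2)) (hγ0 : γ 0 = g) {η : E}
    (hη : ∀ τ, logDeriv E (fun s => γ s τ) 0 = η) (t : ℝ) {w : E}
    (hw : (show E from velocity E (fun s => γ s t) 0) = w) :
    eulerLagrange (fun q => L q a₀) (glm Ξ g) t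
      (leftTranslate (Ξ t) (show TangentSpace 𝓘(ℝ, E) (g t) from w)) =
      residual ρ L a₀ Ξ g t η := by
  subst hγ0 hw
  refine (eulerLagrange_glm hL hinv a₀ hΞ hγ hη t).trans ?_
  have hf := contDiff_fluctuatingLagrangian ρ hL hΞ
  have hp := contDiff_curveVars ρ a₀ (contMDiff_curve_snd hγ 0)
  have h := hasDerivAt_fderiv_apply (t := t) hf.contDiffAt
    ((hp.differentiable (by simp)) t).hasDerivAt
    (hasDerivAt_const t ((0 : ℝ), η, (0 : StrongDual ℝ V)))
  rw [map_zero, add_zero] at h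
  exact congrArg _ h.deriv

/-- Move `g` rigidly from the left by `ψ s 0 * (g t)⁻¹`, with `s ↦ ψ s 0` leaving `g t` in the
direction `w`. The resulting `η` is the same for all times and for all `σ`, so the identity can be
averaged. -/
theorem exists_eulerLagrange_eq_residual (hL : SmoothLagrangian L) (hinv : RightInvariant ρ L)
    (a₀ : StrongDual ℝ V) (hΞ : ∀ σ, ContMDiff 𝓘(ℝ, ℝ) 𝓘(ℝ, E) ∞ (Ξ σ))
    (hg : ContMDiff 𝓘(ℝ, ℝ) 𝓘(ℝ, E) ∞ g) (t : ℝ) (w : TangentSpace 𝓘(ℝ, E) (g t)) :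
    ∃ η : E, ∀ σ, eulerLagrange (fun q => L q a₀) (glm (Ξ σ) g) t (leftTranslate (Ξ σ t) w) =
      residual ρ L a₀ (Ξ σ) g t η := by
  obtain ⟨ψ, hψ, hψ0, -, hψd⟩ := exists_variation (E := E) (g t) (show E from w) (θ := fun _ => 1)
    contDiff_const (C := 1) (by simp)
  have h0 := contMDiff_curve_fst hψ 0
  let γ : ℝ → ℝ → G := fun s τ => ψ s 0 * ((g t)⁻¹ * g τ)
  have hγ : ContMDiff 𝓘(ℝ, ℝ × ℝ) 𝓘(ℝ, E) ∞ (fun p : ℝ × ℝ => γ p.1 p.2) :=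
    (h0.comp contDiff_fst.contMDiff).mul (contMDiff_const.mul (hg.comp contDiff_snd.contMDiff))
  have hγ0 : γ 0 = g := by funext τ; simp [γ, hψ0]
  refine ⟨logDeriv E (fun s => ψ s 0) 0, fun σ => ?_⟩
  refine eulerLagrange_eq_residual hL hinv a₀ (hΞ σ) hγ hγ0
    (fun τ => logDeriv_mul_const (fun s => ψ s 0) 0 _) t ?_
  have hd : MDifferentiableAt 𝓘(ℝ, ℝ) 𝓘(ℝ, E) (fun s => γ s t) 0 :=
    (contMDiff_curve_fst hγ t).mdifferentiable (by simp) 0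
  refine (mfderiv_eq_fderiv_chart (p := g t) hd (by simp [γ, hψ0]) (1 : ℝ)).trans ?_
  rw [fderiv_apply_one_eq_deriv]
  have h1 := (hψd 0).trans (one_smul ℝ (show E from w))
  have hfun : (fun s => extChartAt 𝓘(ℝ, E) (g t) (γ s t)) =
      fun s => extChartAt 𝓘(ℝ, E) (g t) (ψ s 0) := by
    funext s; simp [γ]
  exact (congrArg (fun f : ℝ → E => deriv f 0) hfun).trans h1

theorem logDeriv_eq_of_one {c : ℝ → G} {t : ℝ} (h : c t = 1) :
    logDeriv E c t = deriv (fun τ => extChartAt 𝓘(ℝ, E) (1 : G) (c τ)) t := by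
  simp [logDeriv, h]

/-- The converse direction moves `g` rigidly by a curve through `1` with derivative `η`. -/
theorem exists_residual_eq_eulerLagrange (hL : SmoothLagrangian L) (hinv : RightInvariant ρ L)
    (a₀ : StrongDual ℝ V) (hΞ : ∀ σ, ContMDiff 𝓘(ℝ, ℝ) 𝓘(ℝ, E) ∞ (Ξ σ))
    (hg : ContMDiff 𝓘(ℝ, ℝ) 𝓘(ℝ, E) ∞ g) (t : ℝ) (η : E) :
    ∃ w : TangentSpace 𝓘(ℝ, E) (g t), ∀ σ,
      eulerLagrange (fun q => L q a₀) (glm (Ξ σ) g) t (leftTranslate (Ξ σ t) w) =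
      residual ρ L a₀ (Ξ σ) g t η := by
  obtain ⟨ψ, hψ, hψ0, -, hψd⟩ := exists_variation (E := E) (1 : G) η (θ := fun _ => 1)
    contDiff_const (C := 1) (by simp)
  have h0 := contMDiff_curve_fst hψ 0
  let γ : ℝ → ℝ → G := fun s τ => ψ s 0 * g τ
  have hγ : ContMDiff 𝓘(ℝ, ℝ × ℝ) 𝓘(ℝ, E) ∞ (fun p : ℝ × ℝ => γ p.1 p.2) :=
    (h0.comp contDiff_fst.contMDiff).mul (hg.comp contDiff_snd.contMDiff)
  have hγ0 : γ 0 = g := by funext τ; simp [γ, hψ0]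
  have hη : logDeriv E (fun s => ψ s 0) 0 = η :=
    (logDeriv_eq_of_one (c := fun s => ψ s 0) (hψ0 0)).trans
      ((hψd 0).trans (one_smul ℝ η))
  exact ⟨(show E from velocity E (fun s => γ s t) 0), fun σ =>
    eulerLagrange_eq_residual hL hinv a₀ (hΞ σ) hγ hγ0
      (fun τ => (logDeriv_mul_const (fun s => ψ s 0) 0 _).trans hη) t rfl⟩

theorem meanEulerLagrange_iff (t₁ t₂ : ℝ) (hL : SmoothLagrangian L) (hinv : RightInvariant ρ L)
    (a₀ : StrongDual ℝ V) (hΞ : ∀ σ, ContMDiff 𝓘(ℝ, ℝ) 𝓘(ℝ, E) ∞ (Ξ σ))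
    (hg : ContMDiff 𝓘(ℝ, ℝ) 𝓘(ℝ, E) ∞ g)
    (hdom : DominatedC2 μ (fun σ => fluctuatingLagrangian ρ L (Ξ σ))) :
    MeanEulerLagrange μ t₁ t₂ L a₀ Ξ g ↔
      ∀ t ∈ Set.Icc t₁ t₂, ∀ η : E, ∫ σ, residual ρ L a₀ (Ξ σ) g t η ∂μ = 0 := by
  refine forall₂_congr fun t _ => ⟨fun h η => ?_, fun h w => ?_⟩
  · obtain ⟨w, hw⟩ := exists_residual_eq_eulerLagrange hL hinv a₀ hΞ hg t η
    have := (h w).2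
    simpa only [hw] using this
  · obtain ⟨η, hη⟩ := exists_eulerLagrange_eq_residual hL hinv a₀ hΞ hg t w
    simp only [hη]
    exact ⟨(family_residual hL a₀ hΞ hg hdom (contDiff_const (c := η))).integrable t, h η⟩

theorem laepEquations_iff (t₁ t₂ : ℝ) (hL : SmoothLagrangian L)
    (a₀ : StrongDual ℝ V) (hΞ : ∀ σ, ContMDiff 𝓘(ℝ, ℝ) 𝓘(ℝ, E) ∞ (Ξ σ))
    (hg : ContMDiff 𝓘(ℝ, ℝ) 𝓘(ℝ, E) ∞ g)
    (hdom : DominatedC2 μ (fun σ => fluctuatingLagrangian ρ L (Ξ σ))) :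
    LAEPEquations μ t₁ t₂ ρ L a₀ Ξ g ↔
      ∀ t ∈ Set.Icc t₁ t₂, ∀ η : E, ∫ σ, residual ρ L a₀ (Ξ σ) g t η ∂μ = 0 := by
  have hf := fun σ => contDiff_fluctuatingLagrangian ρ hL (hΞ σ)
  have hp := contDiff_curveVars ρ a₀ hg
  have hm : ∀ τ (η : E), meanMomentum μ ρ L a₀ Ξ g τ η =
      ∫ σ, fderiv ℝ (fluctuatingLagrangian ρ L (Ξ σ)) (curveVars ρ a₀ g τ) (0, η, 0) ∂μ :=
    fun τ η => integral_congr_ae (Filter.Eventually.of_forall fun σ =>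
      derivVelocity_tangentFactor ρ hL a₀ (hΞ σ) hg τ η)
  have hF : ∀ τ α, meanForce μ ρ L a₀ Ξ g τ α =
      ∫ σ, fderiv ℝ (fluctuatingLagrangian ρ L (Ξ σ)) (curveVars ρ a₀ g τ) (0, 0, α) ∂μ :=
    fun τ α => integral_congr_ae (Filter.Eventually.of_forall fun σ =>
      derivAdvected_factorInv ρ hL a₀ (hΞ σ) hg τ α)
  refine forall₂_congr fun t _ => forall_congr' fun (η : E) => ?_
  have hd := hdom.hasDerivAt_mean_fderiv hf hp
    (contDiff_const (c := ((0 : ℝ), (η : E), (0 : StrongDual ℝ V)))) t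
  simp only [deriv_const, map_zero, add_zero] at hd
  have hfun : (fun τ => meanMomentum μ ρ L a₀ Ξ g τ η) = fun τ =>
      ∫ σ, fderiv ℝ (fluctuatingLagrangian ρ L (Ξ σ)) (curveVars ρ a₀ g τ) (0, (η : E), 0) ∂μ :=
    funext fun τ => hm τ η
  have I : ∀ v, Integrable (fun σ => fderiv ℝ (fluctuatingLagrangian ρ L (Ξ σ))
      (curveVars ρ a₀ g t) v) μ := fun v =>
    (hdom.family_fderiv hf hp.continuous (continuous_const (y := v))).integrable t
  have I2 : Integrable (fun σ => fderiv ℝ (fderiv ℝ (fluctuatingLagrangian ρ L (Ξ σ)))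
      (curveVars ρ a₀ g t) (deriv (curveVars ρ a₀ g) t) (0, (η : E), 0)) μ :=
    (hdom.family_fderiv_fderiv hf hp.continuous (hp.continuous_deriv (by simp))
      (continuous_const (y := ((0 : ℝ), (η : E), (0 : StrongDual ℝ V))))).integrable t
  have hu : (show E from eulerVelocity E g t) = logDeriv E g t :=
    eulerVelocity_eq_logDeriv (hg.mdifferentiable (by simp) t)
  have had : (show E from ad (eulerVelocity E g t) η) = adOp G (logDeriv E g t) η :=
    congrArg (fun x : E => adOp G x η) hu
  -- The coadjoint and diamond terms are the two components of the mean derivative along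
  -- `transportVars`.
  have hrhs : -coad (eulerVelocity E g t) (meanMomentum μ ρ L a₀ Ξ g t) η
        + ρ.diamond (meanForce μ ρ L a₀ Ξ g t) (ρ.advected a₀ g t) η =
      ∫ σ, fderiv ℝ (fluctuatingLagrangian ρ L (Ξ σ)) (curveVars ρ a₀ g t)
        (transportVars ρ a₀ g t η) ∂μ := by
    have e1 : -coad (eulerVelocity E g t) (meanMomentum μ ρ L a₀ Ξ g t) η =
        ∫ σ, fderiv ℝ (fluctuatingLagrangian ρ L (Ξ σ)) (curveVars ρ a₀ g t)
          (0, adOp G (logDeriv E g t) η, 0) ∂μ := by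
      refine (neg_neg _).trans ?_
      rw [← had]
      exact hm t _
    have e2 : ρ.diamond (meanForce μ ρ L a₀ Ξ g t) (ρ.advected a₀ g t) η =
        ∫ σ, fderiv ℝ (fluctuatingLagrangian ρ L (Ξ σ)) (curveVars ρ a₀ g t)
          (0, 0, -((a₀.comp (ρ.act (g t))).comp (ρ.infOp η))) ∂μ := by
      have ha : ρ.infAct (ρ.advected a₀ g t) η = (a₀.comp (ρ.act (g t))).comp (ρ.infOp η) :=
        (ρ.infAct_eq _ _).trans (by rw [ρ.advected_eq])
      refine (congrArg (fun α => -meanForce μ ρ L a₀ Ξ g t α) ha).trans ?_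
      rw [hF, ← integral_neg]
      refine integral_congr_ae (Filter.Eventually.of_forall fun σ => ?_)
      beta_reduce
      rw [← map_neg]
      congr 1
      simp
    rw [e1, e2, ← integral_add (I _) (I _)]
    refine integral_congr_ae (Filter.Eventually.of_forall fun σ => ?_)
    beta_reduce
    rw [← map_add]
    congr 1
    simp [transportVars]
  rw [hfun, hrhs]
  have hres : ∫ σ, residual ρ L a₀ (Ξ σ) g t η ∂μ = _ := integral_sub (I _) I2
  rw [hres, sub_eq_zero]
  -- The momentum is differentiable in any case with derivative `hd`, so the equation only compares
  -- values of derivatives.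
  constructor
  · exact fun h => h.unique hd
  · intro h
    rw [h]
    exact hd

/-- The first variation exists for every curve `g`, critical or not; stationarity therefore amounts
to the vanishing of this integral. -/
theorem hasDerivAt_averagedHamilton (hL : SmoothLagrangian L) (hinv : RightInvariant ρ L)
    (a₀ : StrongDual ℝ V) (hΞ : ∀ σ, ContMDiff 𝓘(ℝ, ℝ) 𝓘(ℝ, E) ∞ (Ξ σ))
    (hg : ContMDiff 𝓘(ℝ, ℝ) 𝓘(ℝ, E) ∞ g)
    (hdom : DominatedC2 μ (fun σ => fluctuatingLagrangian ρ L (Ξ σ))) {t₁ t₂ : ℝ}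
    {γ : ℝ → ℝ → G} (hγ : IsVariation E t₁ t₂ g γ) :
    HasDerivAt (fun s : ℝ => ∫ t in t₁..t₂, ∫ σ, L (lift E (glm (Ξ σ) (γ s)) t) a₀ ∂μ)
      (∫ t in t₁..t₂, ∫ σ, residual ρ L a₀ (Ξ σ) g t (logDeriv E (fun s => γ s t) 0) ∂μ) 0 := by
  obtain ⟨hsm, h0, h1, h2⟩ := hγ
  have hf := fun σ => contDiff_fluctuatingLagrangian ρ hL (hΞ σ)
  have h := hdom.hasDerivAt_action hf (contDiff_meanVars ρ a₀ hsm) t₁ t₂ 0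
  have hη : ContDiff ℝ ∞ (fun t => logDeriv E (fun s => γ s t) 0) :=
    (contDiff_logDeriv_snd hsm).comp (f := fun t : ℝ => ((0 : ℝ), t))
      (contDiff_const.prodMk contDiff_id)
  have hz : ∀ t, (∀ s, γ s t = g t) → logDeriv E (fun s => γ s t) 0 = 0 := by
    intro t ht
    simp [logDeriv, ht]
  rw [← integral_residual hL a₀ hΞ hg hdom hη (hz _ h1) (hz _ h2)]
  have e1 : (fun s : ℝ => ∫ t in t₁..t₂, ∫ σ, L (lift E (glm (Ξ σ) (γ s)) t) a₀ ∂μ) =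
      fun s => ∫ t in t₁..t₂, ∫ σ, fluctuatingLagrangian ρ L (Ξ σ) (meanVars ρ a₀ γ (s, t)) ∂μ := by
    funext s
    simp_rw [fun σ t => lagrangian_lift_glm hinv a₀ (hΞ σ) (contMDiff_curve_snd hsm s) t]
    rfl
  rw [e1]
  convert h using 1
  refine intervalIntegral.integral_congr fun t _ => ?_
  refine integral_congr_ae (Filter.Eventually.of_forall fun σ => ?_)
  beta_reduce
  rw [(hasDerivAt_meanVars ρ a₀ hsm 0 t).deriv, h0]
  have h3 : meanVars ρ a₀ γ (0, t) = curveVars ρ a₀ g t := by rw [meanVars, h0]; rfl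
  rw [h3]
  congr 1
  simp [transportVars]

theorem averagedHamilton_iff {t₁ t₂ : ℝ} (ht : t₁ < t₂) (hL : SmoothLagrangian L)
    (hinv : RightInvariant ρ L)
    (a₀ : StrongDual ℝ V) (hΞ : ∀ σ, ContMDiff 𝓘(ℝ, ℝ) 𝓘(ℝ, E) ∞ (Ξ σ))
    (hg : ContMDiff 𝓘(ℝ, ℝ) 𝓘(ℝ, E) ∞ g)
    (hdom : DominatedC2 μ (fun σ => fluctuatingLagrangian ρ L (Ξ σ))) :
    AveragedHamilton μ t₁ t₂ L a₀ Ξ g ↔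
      ∀ t ∈ Set.Icc t₁ t₂, ∀ η : E, ∫ σ, residual ρ L a₀ (Ξ σ) g t η ∂μ = 0 := by
  constructor
  · intro h t htI η
    refine mean_residual_eq_zero hL a₀ hΞ hg hdom ht η (fun θ hθ hθc h₁ h₂ => ?_) t htI
    -- Compact support bounds `θ`, as required to keep the variation inside one chart for all times.
    obtain ⟨C, hC⟩ := hθc.exists_bound_of_continuous hθ.continuous
    obtain ⟨ψ, hψ, hψ0, hψz, hψd⟩ := exists_variation (E := E) (1 : G) η hθ hC
    have hγ : IsVariation E t₁ t₂ g (fun s t => ψ s t * g t) := by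
      refine ⟨hψ.mul (hg.comp contDiff_snd.contMDiff), ?_, ?_, ?_⟩
      · funext t; simp [hψ0]
      · intro s; simp [hψz s t₁ h₁]
      · intro s; simp [hψz s t₂ h₂]
    have h3 := (hasDerivAt_averagedHamilton hL hinv a₀ hΞ hg hdom hγ).unique (h _ hγ)
    have hl : ∀ t, logDeriv E (fun s => ψ s t * g t) 0 = θ t • η := fun t =>
      (logDeriv_mul_const (fun s => ψ s t) 0 (g t)).trans
        ((logDeriv_eq_of_one (c := fun s => ψ s t) (hψ0 t)).trans (hψd t))
    simpa only [hl] using h3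
  · intro h γ hγ
    have h3 := hasDerivAt_averagedHamilton hL hinv a₀ hΞ hg hdom hγ
    rwa [intervalIntegral.integral_congr (g := fun _ => (0 : ℝ)), intervalIntegral.integral_zero] at h3
    intro t htI
    rw [Set.uIcc_of_le ht.le] at htI
    exact h t htI _

/-- Here the mean variables move along a straight line, which need not come from curves in `G`. Only
the tangent vector at `ε = 0` matters, and it has the same form as for an actual variation. -/
theorem hasDerivAt_averagedReduced (hL : SmoothLagrangian L)
    (a₀ : StrongDual ℝ V) (hΞ : ∀ σ, ContMDiff 𝓘(ℝ, ℝ) 𝓘(ℝ, E) ∞ (Ξ σ))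
    (hg : ContMDiff 𝓘(ℝ, ℝ) 𝓘(ℝ, E) ∞ g)
    (hdom : DominatedC2 μ (fun σ => fluctuatingLagrangian ρ L (Ξ σ))) {t₁ t₂ : ℝ}
    {η : ℝ → E} (hη : ContDiff ℝ ∞ η) (h₁ : η t₁ = 0) (h₂ : η t₂ = 0) :
    HasDerivAt (fun ε : ℝ => ∫ t in t₁..t₂, ∫ σ, fluctuatingLagrangian ρ L (Ξ σ)
        (curveVars ρ a₀ g t + ε • ((0, deriv η t, 0) + transportVars ρ a₀ g t (η t))) ∂μ)
      (∫ t in t₁..t₂, ∫ σ, residual ρ L a₀ (Ξ σ) g t (η t) ∂μ) 0 := by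
  have hf := fun σ => contDiff_fluctuatingLagrangian ρ hL (hΞ σ)
  have hv : ContDiff ℝ ∞ (fun t => ((0 : ℝ), deriv η t, (0 : StrongDual ℝ V))
      + transportVars ρ a₀ g t (η t)) :=
    (contDiff_const.prodMk ((contDiff_infty_iff_deriv.1 hη).2.prodMk contDiff_const)).add
      (contDiff_transportVars ρ a₀ hg hη)
  have hp : ContDiff ℝ ∞ (fun q : ℝ × ℝ => curveVars ρ a₀ g q.2 + q.1 •
      (((0 : ℝ), deriv η q.2, (0 : StrongDual ℝ V)) + transportVars ρ a₀ g q.2 (η q.2))) :=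
    ((contDiff_curveVars ρ a₀ hg).comp contDiff_snd).add
      (contDiff_fst.smul (hv.comp contDiff_snd))
  rw [← integral_residual hL a₀ hΞ hg hdom hη h₁ h₂]
  convert hdom.hasDerivAt_action hf hp t₁ t₂ 0 using 1
  refine intervalIntegral.integral_congr fun t _ => ?_
  refine integral_congr_ae (Filter.Eventually.of_forall fun σ => ?_)
  have h3 : HasDerivAt (fun r : ℝ => curveVars ρ a₀ g t + r •
      (((0 : ℝ), deriv η t, (0 : StrongDual ℝ V)) + transportVars ρ a₀ g t (η t)))
      (((0 : ℝ), deriv η t, (0 : StrongDual ℝ V)) + transportVars ρ a₀ g t (η t)) 0 := by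
    simpa using ((hasDerivAt_id (0 : ℝ)).smul_const
      (((0 : ℝ), deriv η t, (0 : StrongDual ℝ V)) + transportVars ρ a₀ g t (η t))).const_add
      (curveVars ρ a₀ g t)
  beta_reduce
  rw [h3.deriv, zero_smul, add_zero]

theorem averagedReducedPrinciple_iff {t₁ t₂ : ℝ} (ht : t₁ < t₂) (hL : SmoothLagrangian L)
    (a₀ : StrongDual ℝ V) (hΞ : ∀ σ, ContMDiff 𝓘(ℝ, ℝ) 𝓘(ℝ, E) ∞ (Ξ σ))
    (hg : ContMDiff 𝓘(ℝ, ℝ) 𝓘(ℝ, E) ∞ g)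
    (hdom : DominatedC2 μ (fun σ => fluctuatingLagrangian ρ L (Ξ σ))) :
    AveragedReducedPrinciple μ t₁ t₂ ρ L a₀ Ξ g ↔
      ∀ t ∈ Set.Icc t₁ t₂, ∀ η : E, ∫ σ, residual ρ L a₀ (Ξ σ) g t η ∂μ = 0 := by
  have key : AveragedReducedPrinciple μ t₁ t₂ ρ L a₀ Ξ g ↔
      ∀ η : ℝ → E, ContDiff ℝ ∞ η → η t₁ = 0 → η t₂ = 0 →
        HasDerivAt (fun ε : ℝ => ∫ t in t₁..t₂, ∫ σ, fluctuatingLagrangian ρ L (Ξ σ)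
          (curveVars ρ a₀ g t + ε • ((0, deriv η t, 0) + transportVars ρ a₀ g t (η t))) ∂μ) 0 0 := by
    refine forall_congr' fun η => forall₃_congr fun hη h₁ h₂ => ?_
    -- The constrained variations of `u^ξ` and `a^ξ` are the images of one nonrandom displacement of
    -- the mean variables.
    have e : ∀ (ε t : ℝ) (σ : Ω), reducedAt L
        (uXi E (Ξ σ) g t + ε • tangentFactor (Ξ σ t) (deriv η t + ad (eulerVelocity E g t) (η t)))
        (ρ.aXi a₀ (Ξ σ) g t + ε • ρ.factorInv (Ξ σ t) (-ρ.infAct (ρ.advected a₀ g t) (η t))) =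
        fluctuatingLagrangian ρ L (Ξ σ) (curveVars ρ a₀ g t +
          ε • ((0, deriv (F := E) η t, 0) + transportVars ρ a₀ g t (η t))) := by
      intro ε t σ
      have h := reducedAt_variation ρ L a₀ (hΞ σ) hg t ε ε
        (deriv η t + ad (eulerVelocity E g t) (η t)) (-ρ.infAct (ρ.advected a₀ g t) (η t))
      refine h.trans (congrArg _ ?_)
      have hu : (show E from eulerVelocity E g t) = logDeriv E g t :=
        eulerVelocity_eq_logDeriv (hg.mdifferentiable (by simp) t)
      have had : (show E from deriv η t + ad (eulerVelocity E g t) (η t)) =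
          deriv (F := E) η t + adOp G (logDeriv E g t) (η t) :=
        congrArg (fun x : E => deriv (F := E) η t + adOp G x (η t)) hu
      rw [had, ρ.infAct_eq, ρ.advected_eq]
      simp [curveVars, transportVars]
    simp only [e]
  rw [key]
  constructor
  · intro h t htI η
    refine mean_residual_eq_zero hL a₀ hΞ hg hdom ht η (fun θ hθ _ h₁ h₂ => ?_) t htI
    have hη : ContDiff ℝ ∞ (fun t => θ t • η) := hθ.smul contDiff_const
    have h1 : θ t₁ • η = 0 := by rw [h₁, zero_smul]
    have h2 : θ t₂ • η = 0 := by rw [h₂, zero_smul]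
    exact (hasDerivAt_averagedReduced hL a₀ hΞ hg hdom hη h1 h2).unique (h _ hη h1 h2)
  · intro h η hη h₁ h₂
    have h3 := hasDerivAt_averagedReduced hL a₀ hΞ hg hdom hη h₁ h₂
    rwa [intervalIntegral.integral_congr (g := fun _ => (0 : ℝ)), intervalIntegral.integral_zero] at h3
    intro t htI
    rw [Set.uIcc_of_le ht.le] at htI
    exact h t htI _

end LAEP

theorem theorem2
    {E : Type*} [NormedAddCommGroup E] [NormedSpace ℝ E] [CompleteSpace E]
    {G : Type*} [TopologicalSpace G] [ChartedSpace E G] [Group G] [LieGroup 𝓘(ℝ, E) ∞ G]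
    {V : Type*} [NormedAddCommGroup V] [NormedSpace ℝ V]
    {M : Type*} [MulAction G M]
    {X : Type*} [NormedAddCommGroup X] [NormedSpace ℝ X] [CompleteSpace X] (pos : M → X)
    {Ω : Type*} [MeasurableSpace Ω] (μ : Measure Ω) [IsProbabilityMeasure μ]
    (ρ : LAEP.RightRep E G V)
    (L : TangentBundle 𝓘(ℝ, E) G → StrongDual ℝ V → ℝ)
    (hL : LAEP.SmoothLagrangian L) (hinv : LAEP.RightInvariant ρ L)
    (a₀ : StrongDual ℝ V) (t₁ t₂ : ℝ) (ht : t₁ < t₂)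
    (Ξ : Ω → ℝ → G) (hΞ : ∀ σ, ContMDiff 𝓘(ℝ, ℝ) 𝓘(ℝ, E) ∞ (Ξ σ))
    (g : ℝ → G) (hg : ContMDiff 𝓘(ℝ, ℝ) 𝓘(ℝ, E) ∞ g)
    (hmean : ∀ t ∈ Set.Icc t₁ t₂, LAEP.MeanIs μ pos (fun σ => LAEP.glm (Ξ σ) g t) (g t))
    (hdom : LAEP.DominatedC2 μ (fun σ => LAEP.fluctuatingLagrangian ρ L (Ξ σ))) :
    List.TFAE
      [LAEP.AveragedHamilton μ t₁ t₂ L a₀ Ξ g,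
       LAEP.MeanEulerLagrange μ t₁ t₂ L a₀ Ξ g,
       LAEP.AveragedReducedPrinciple μ t₁ t₂ ρ L a₀ Ξ g,
       LAEP.LAEPEquations μ t₁ t₂ ρ L a₀ Ξ g] := by
  have h1 := LAEP.averagedHamilton_iff ht hL hinv a₀ hΞ hg hdom
  have h2 := LAEP.meanEulerLagrange_iff t₁ t₂ hL hinv a₀ hΞ hg hdom
  have h3 := LAEP.averagedReducedPrinciple_iff ht hL a₀ hΞ hg hdom
  have h4 := LAEP.laepEquations_iff t₁ t₂ hL a₀ hΞ hg hdom
  tfae_have 1 ↔ 2 := h1.trans h2.symm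
  tfae_have 2 ↔ 3 := h2.trans h3.symm
  tfae_have 3 ↔ 4 := h3.trans h4.symm
  tfae_finish
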